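/- Let $N\ge 1$. For $t>0$ and a real-valued locally integrable function $\varphi$ on $\mathbb R^N$ let $$[S(t)\varphi](x)=\int_{\mathbb R^N}G(x-y,t)\,\varphi(y)\,dy,\qquad G(x,t)=(4\pi t)^{-N/2}\exp\left(-\frac{|x|^2}{4t}\right).$$ For a measurable function $f$ on $\mathbb R^N$ let $f^*(s)=\inf\{\lambda>0:\ |\{x:|f(x)|>\lambda\}|\le s\}$ (with $\inf\emptyset=\infty$) be its non-increasing rearrangement and let $f^{**}(s)=\frac1s\int_0^s f^*(\tau)\,d\tau$ for $s>0$. Let $\Phi$ be a non-decreasing real function on $[0,\infty)$ such that - ($\Phi$1) $\Phi(0)=1$; - ($\Phi$2) there is $C>0$ with $\Phi(a^2)\le C\,\Phi(a)$ for all $a\ge 0$; - ($\Phi$3) for every $\delta>0$ there are $C_\delta>0$ and $\tau_\delta>0$ with $\tau_2^{-\delta}\Phi(\tau_2)\le C_\delta\,\tau_1^{-\delta}\Phi(\tau_1)$ whenever $\tau_\delta\le\tau_1\le\tau_2$. For $r\in[1,\infty)$ and $\alpha\ge0$ put $$\|f\|_{L^{r,\infty}\Phi(L)^\alpha}=\sup_{s>0}\left\{s\,\Phi(s^{-1})^\alpha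 f^*(s)^r\right\}^{1/r},\qquad \|f\|_{\mathfrak L^{r,\infty}\Phi(\mathfrak L)^\alpha}=\sup_{s>0}\left\{s\,\Phi(s^{-1})^\alpha(|f|^r)^{**}(s)\right\}^{1/r},$$ and for $r=\infty$ let both be $\|f\|_{L^\infty}$. Let $L^{r,\infty}\Phi(L)^\alpha$ and $\mathfrak L^{r,\infty}\Phi(\mathfrak L)^\alpha$ be the sets of locally integrable functions on $\mathbb R^N$ for which the respective quantity is finite. **Proposition 3.1.** Let $1\le r_1\le r_2\le\infty$ and $\alpha,\beta\ge0$, and assume $\alpha\le\beta$ if $r_1=r_2$. Put $1/\infty=0$ and $$D(t)=t^{-\frac N2\left(\frac1{r_1}-\frac1{r_2}\right)}\,\Phi(t^{-1})^{-\frac{\alpha}{r_1}+\frac{\beta}{r_2}},\qquad t>0.$$ 1. There is a constant $C_1>0$ such that $\|S(t)\varphi\|_{\mathfrak L^{r_2,\infty}\Phi(\mathfrak L)^\beta}\le C_1D(t)\,\|\varphi\|_{\mathfrak L^{r_1,\infty}\Phi(\mathfrak L)^\alpha}$ for all $\varphi\in\mathfrak L^{r_1,\infty}\Phi(\mathfrak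 L)^\alpha$ and all $t>0$. 2. If $r_1>1$, there is a constant $C_2>0$ such that $\|S(t)\varphi\|_{L^{r_2,\infty}\Phi(L)^\beta}\le C_2D(t)\,\|\varphi\|_{L^{r_1,\infty}\Phi(L)^\alpha}$ for all $\varphi\in L^{r_1,\infty}\Phi(L)^\alpha$ and all $t>0$. 3. If $1<r_1<r_2$, there is a constant $C_3>0$ such that $\|S(t)\varphi\|_{\mathfrak L^{r_2,\infty}\Phi(\mathfrak L)^\beta}\le C_3D(t)\,\|\varphi\|_{L^{r_1,\infty}\Phi(L)^\alpha}$ for all $\varphi\in L^{r_1,\infty}\Phi(L)^\alpha$ and all $t>0$. The constants depend only on $N,\Phi,r_1,r_2,\alpha,\beta$. In each case the integral defining $[S(t)\varphi](x)$ converges absolutely for every $x\in\mathbb R^N$, and $S(t)\varphi$ belongs to the space on the left-hand side. -/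

import Mathlib

open MeasureTheory Set
open scoped ENNReal

noncomputable section

namespace WeakZygmund

/-- The space `ℝ^N` with its Euclidean norm (and Lebesgue measure as `volume`). -/
abbrev Space (N : ℕ) : Type := EuclideanSpace ℝ (Fin N)

/-- The Gauss kernel `G(x,t) = (4πt)^{-N/2} exp(-|x|²/(4t))` on `ℝ^N`. -/
def gaussKernel (N : ℕ) (t : ℝ) (x : Space N) : ℝ :=
  (4 * Real.pi * t) ^ (-(N : ℝ) / 2) * Real.exp (-‖x‖ ^ 2 / (4 * t))

/-- The heat semigroup `[S(t)φ](x) = ∫ G(x-y,t) φ(y) dy`. -/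
def heatSemigroup (N : ℕ) (t : ℝ) (φ : Space N → ℝ) (x : Space N) : ℝ :=
  ∫ y, gaussKernel N t (x - y) * φ y

/-- The distribution function `μ_f(l) = |{x : |f(x)| > l}|`. -/
def distributionFun {N : ℕ} (f : Space N → ℝ) (l : ℝ) : ℝ≥0∞ :=
  volume {x | l < |f x|}

/-- The non-increasing rearrangement `f^*(s) = inf {l > 0 : μ_f(l) ≤ s}`, where `inf ∅ = ∞`. -/
def rearrangement {N : ℕ} (f : Space N → ℝ) (s : ℝ) : ℝ≥0∞ :=
  ⨅ (l : ℝ) (_ : 0 < l) (_ : distributionFun f l ≤ ENNReal.ofReal s), ENNReal.ofReal l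

/-- The averaged rearrangement `f^{**}(s) = s⁻¹ ∫_0^s f^*(τ) dτ`, used for `s > 0`. -/
def averagedRearrangement {N : ℕ} (f : Space N → ℝ) (s : ℝ) : ℝ≥0∞ :=
  (ENNReal.ofReal s)⁻¹ * ∫⁻ τ in Ioo 0 s, rearrangement f τ

/-- The assumptions on the weight `Φ`; only its values on `[0,∞)` are used. -/
structure IsWeight (Φ : ℝ → ℝ) : Prop where
  monotoneOn : MonotoneOn Φ (Ici 0)
  map_zero : Φ 0 = 1
  map_sq_le : ∃ C : ℝ, 0 < C ∧ ∀ a : ℝ, 0 ≤ a → Φ (a ^ 2) ≤ C * Φ a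
  almost_decreasing : ∀ δ : ℝ, 0 < δ → ∃ C τ₀ : ℝ, 0 < C ∧ 0 < τ₀ ∧
    ∀ τ₁ τ₂ : ℝ, τ₀ ≤ τ₁ → τ₁ ≤ τ₂ → τ₂ ^ (-δ) * Φ τ₂ ≤ C * (τ₁ ^ (-δ) * Φ τ₁)

/-- The quasi-norm of `L^{r,∞}Φ(L)^α`: it is `sup_{s>0} {s Φ(s⁻¹)^α f^*(s)^r}^{1/r}` for `r < ∞`,
and the `L^∞` norm for `r = ∞`. -/
def weakNorm {N : ℕ} (Φ : ℝ → ℝ) (r : ℝ≥0∞) (α : ℝ) (f : Space N → ℝ) : ℝ≥0∞ :=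
  if r = ∞ then eLpNorm f ∞ volume
  else ⨆ (s : ℝ) (_ : 0 < s),
    (ENNReal.ofReal s * ENNReal.ofReal (Φ s⁻¹ ^ α) * rearrangement f s ^ r.toReal) ^ (1 / r.toReal)

/-- The norm of `𝔏^{r,∞}Φ(𝔏)^α`: it is `sup_{s>0} {s Φ(s⁻¹)^α (|f|^r)^{**}(s)}^{1/r}` for `r < ∞`,
and the `L^∞` norm for `r = ∞`. -/
def strongNorm {N : ℕ} (Φ : ℝ → ℝ) (r : ℝ≥0∞) (α : ℝ) (f : Space N → ℝ) : ℝ≥0∞ :=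
  if r = ∞ then eLpNorm f ∞ volume
  else ⨆ (s : ℝ) (_ : 0 < s),
    (ENNReal.ofReal s * ENNReal.ofReal (Φ s⁻¹ ^ α) *
      averagedRearrangement (fun x => |f x| ^ r.toReal) s) ^ (1 / r.toReal)

/-- The weak Zygmund type space `L^{r,∞}Φ(L)^α`. -/
def weakSpace (N : ℕ) (Φ : ℝ → ℝ) (r : ℝ≥0∞) (α : ℝ) : Set (Space N → ℝ) :=
  {f | LocallyIntegrable f volume ∧ weakNorm Φ r α f < ∞}

/-- The weak Zygmund type space `𝔏^{r,∞}Φ(𝔏)^α`. -/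
def strongSpace (N : ℕ) (Φ : ℝ → ℝ) (r : ℝ≥0∞) (α : ℝ) : Set (Space N → ℝ) :=
  {f | LocallyIntegrable f volume ∧ strongNorm Φ r α f < ∞}

/-- The factor `t^{-(N/2)(1/r₁-1/r₂)} Φ(t⁻¹)^{-α/r₁+β/r₂}`, where `1/∞ = 0`. -/
def decayFactor (N : ℕ) (Φ : ℝ → ℝ) (r₁ r₂ : ℝ≥0∞) (α β t : ℝ) : ℝ :=
  t ^ (-((N : ℝ) / 2) * ((r₁⁻¹).toReal - (r₂⁻¹).toReal)) *
    Φ t⁻¹ ^ (-α * (r₁⁻¹).toReal + β * (r₂⁻¹).toReal)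

/-- The integral defining `[S(t)φ](x)` converges absolutely for every `x`. -/
def HeatIntegrable (N : ℕ) (t : ℝ) (φ : Space N → ℝ) : Prop :=
  ∀ x : Space N, Integrable (fun y => gaussKernel N t (x - y) * φ y) volume

end WeakZygmund

end

/-! The engine is the identity `∫_0^s g^* = s·c + ∫ (g - c)_+` with `c = g^*(s)`, where `≤` holds
for every finite `c`. If `k ≥ 0` has mass one, then `(k ∗ g - c)_+ ≤ k ∗ (g - c)_+`, and the latter
has the same integral as `(g - c)_+`. Hence convolution with `k` does not increase `∫_0^s g^*`
(`lintegral_decRearr_kernelMean_le`). If moreover `k ≤ 1/T`, then `T·(k ∗ g)(x) ≤ ∫_0^T g^*`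
(`ofReal_mul_kernelMean_le`). The Gauss kernel qualifies with `T = t^{N/2}`.

Write `w(s) = s^{-1/r₁} Φ(1/s)^{-α/r₁}`. These two facts, combined with Jensen for the strong norm
or with Hardy's inequality for the weak norm (which needs `r₁ > 1`), show that `u = S(t)φ` keeps its
`r₁`-norm up to a constant and satisfies `|u| ≤ A·w(T)`, with `A` a multiple of the norm of `φ`.

The rest is real interpolation for a single function: `u^*` is at most `A·w(T)` everywhere, and at
most `A·w(s)` at `s`. For `r₁ < r₂`, splitting `∫ (u^*)^{r₂}` at `T` gives even the strong norm from
the weak one; for `r₁ = r₂` the two ranges of `s` are treated directly. Throughout, `Φ` behaves like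
a slowly varying function: (Φ3) makes it negligible against any power, and (Φ2) turns `Φ(1/T)` into
`Φ(1/t)`. -/

noncomputable section

namespace WeakZygmund

/-! ### Rearrangements and the layer-cake formula. -/

section Rearrangement

variable {X : Type*} [MeasurableSpace X] {μ : Measure X}

/-- The non-increasing rearrangement of a function with values in `[0,∞]`. -/
def decRearr (μ : Measure X) (g : X → ℝ≥0∞) (s : ℝ) : ℝ≥0∞ :=
  sInf {l | μ {x | l < g x} ≤ ENNReal.ofReal s}

/-- The infimum is attained: the superlevel set at `c` is the increasing union of those at levels
decreasing to `c`, and continuity from below needs no measurability. -/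
theorem measure_decRearr_lt_le (g : X → ℝ≥0∞) (s : ℝ) :
    μ {x | decRearr μ g s < g x} ≤ ENNReal.ofReal s := by
  set c := decRearr μ g s with hc
  rcases eq_or_ne c ∞ with h | h
  · simp [h]
  obtain ⟨u, hu, hlt, hlim⟩ := exists_seq_strictAnti_tendsto' (lt_top_iff_ne_top.2 h)
  have : {x | c < g x} = ⋃ n, {x | u n < g x} := by
    ext x
    simp only [mem_ofPred_eq, mem_iUnion]
    constructor
    · intro hx
      exact (hlim.eventually (eventually_lt_nhds hx)).exists
    · rintro ⟨n, hn⟩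
      exact (hlt n).1.trans hn
  rw [this, Monotone.measure_iUnion]
  · refine iSup_le fun n => ?_
    obtain ⟨l, hl, hlu⟩ := sInf_lt_iff.1 (hlt n).1
    exact (measure_mono fun x hx => hlu.trans hx).trans hl
  · intro m n hmn x hx
    exact (hu.antitone hmn).trans_lt hx

theorem decRearr_le_iff {g : X → ℝ≥0∞} {s : ℝ} {l : ℝ≥0∞} :
    decRearr μ g s ≤ l ↔ μ {x | l < g x} ≤ ENNReal.ofReal s :=
  ⟨fun h => (measure_mono fun _ hx => h.trans_lt hx).trans (measure_decRearr_lt_le g s),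
    fun h => sInf_le h⟩

theorem lt_decRearr_iff {g : X → ℝ≥0∞} {s : ℝ} {l : ℝ≥0∞} :
    l < decRearr μ g s ↔ ENNReal.ofReal s < μ {x | l < g x} := by
  rw [← not_le, decRearr_le_iff, not_le]

theorem antitone_decRearr (g : X → ℝ≥0∞) : Antitone (decRearr μ g) := fun _ _ h =>
  decRearr_le_iff.2 ((measure_decRearr_lt_le g _).trans (ENNReal.ofReal_le_ofReal h))

theorem decRearr_mono {f g : X → ℝ≥0∞} (h : ∀ x, f x ≤ g x) (s : ℝ) :
    decRearr μ f s ≤ decRearr μ g s :=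
  decRearr_le_iff.2 ((measure_mono fun x hx => lt_of_lt_of_le hx (h x)).trans
    (measure_decRearr_lt_le g s))

theorem decRearr_le_of_forall_le {g : X → ℝ≥0∞} {b : ℝ≥0∞} (h : ∀ x, g x ≤ b) (s : ℝ) :
    decRearr μ g s ≤ b := by
  rw [decRearr_le_iff]
  have : {x | b < g x} = ∅ := by
    ext x
    simpa using h x
  simp [this]

theorem decRearr_rpow (g : X → ℝ≥0∞) {r : ℝ} (hr : 0 < r) (s : ℝ) :
    decRearr μ (fun x => g x ^ r) s = decRearr μ g s ^ r := by
  refine eq_of_forall_ge_iff fun l => ?_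
  rw [decRearr_le_iff, ← ENNReal.le_rpow_inv_iff hr, decRearr_le_iff]
  simp_rw [← ENNReal.rpow_inv_lt_iff hr]

/-- Layer cake for the excess over `c`: write `a - c` as the length of `(c, a)` and apply Tonelli.
-/
theorem lintegral_sub_eq_lintegral_measure_lt [SFinite μ] {g : X → ℝ≥0∞} (hg : AEMeasurable g μ)
    (c : ℝ≥0∞) (hc : c ≠ ∞) :
    ∫⁻ x, (g x - c) ∂μ = ∫⁻ l in Ioi c.toReal, μ {x | ENNReal.ofReal l < g x} := by
  wlog hm : Measurable g generalizing g
  · have hae := hg.ae_eq_mk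
    rw [lintegral_congr_ae (g := fun x => hg.mk g x - c) (hae.mono fun x hx => by simp [hx]),
      this hg.measurable_mk.aemeasurable hg.measurable_mk]
    refine lintegral_congr fun l => measure_congr ?_
    filter_upwards [hae] with x hx
    exact propext (show ENNReal.ofReal l < hg.mk g x ↔ ENNReal.ofReal l < g x by rw [hx])
  have key : ∀ a : ℝ≥0∞, a - c =
      ∫⁻ l in Ioi c.toReal, {l : ℝ | ENNReal.ofReal l < a}.indicator 1 l := by
    intro a
    have hms : MeasurableSet {l : ℝ | ENNReal.ofReal l < a} :=
      measurableSet_lt ENNReal.measurable_ofReal measurable_const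
    rw [lintegral_indicator_one hms, Measure.restrict_apply hms]
    rcases eq_or_ne a ∞ with rfl | ha
    · simp [ENNReal.top_sub hc]
    · have : {l : ℝ | ENNReal.ofReal l < a} ∩ Ioi c.toReal = Ioo c.toReal a.toReal := by
        ext l
        simp only [mem_inter_iff, mem_ofPred_eq, mem_Ioi, mem_Ioo]
        constructor
        · rintro ⟨h1, h2⟩
          exact ⟨h2, (ENNReal.ofReal_lt_iff_lt_toReal (ENNReal.toReal_nonneg.trans h2.le) ha).1 h1⟩
        · rintro ⟨h1, h2⟩
          exact ⟨(ENNReal.ofReal_lt_iff_lt_toReal (ENNReal.toReal_nonneg.trans h1.le) ha).2 h2, h1⟩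
      rw [this, Real.volume_Ioo, ENNReal.ofReal_sub _ ENNReal.toReal_nonneg,
        ENNReal.ofReal_toReal ha, ENNReal.ofReal_toReal hc]
  have hset : MeasurableSet {p : X × ℝ | ENNReal.ofReal p.2 < g p.1} :=
    measurableSet_lt (ENNReal.measurable_ofReal.comp measurable_snd) (hm.comp measurable_fst)
  simp_rw [key]
  rw [lintegral_lintegral_swap]
  · refine lintegral_congr fun l => ?_
    have hms : MeasurableSet {x | ENNReal.ofReal l < g x} := measurableSet_lt measurable_const hm
    rw [← lintegral_indicator_one hms]
    rfl
  · exact (measurable_one.indicator hset).aemeasurable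

/-- The set where `g^* > l` is an initial interval of length `μ {g > l}`; cutting it at `s` produces
the minimum. -/
theorem lintegral_decRearr_sub_eq (g : X → ℝ≥0∞) (s : ℝ) (c : ℝ≥0∞) (hc : c ≠ ∞) :
    ∫⁻ τ in Ioo 0 s, (decRearr μ g τ - c) = ∫⁻ l in Ioi c.toReal,
      min (ENNReal.ofReal s) (μ {x | ENNReal.ofReal l < g x}) := by
  have hm : Measurable (decRearr μ g) := (antitone_decRearr g).measurable
  rw [lintegral_sub_eq_lintegral_measure_lt hm.aemeasurable c hc]
  refine lintegral_congr fun l => ?_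
  simp_rw [lt_decRearr_iff]
  generalize μ {x | ENNReal.ofReal l < g x} = m
  rw [Measure.restrict_apply (measurableSet_lt ENNReal.measurable_ofReal measurable_const)]
  rcases eq_or_ne m ∞ with rfl | hmt
  · simp
  have : {τ : ℝ | ENNReal.ofReal τ < m} ∩ Ioo 0 s = Ioo 0 (min s m.toReal) := by
    ext τ
    simp only [mem_inter_iff, mem_ofPred_eq, mem_Ioo, lt_min_iff]
    constructor
    · rintro ⟨h1, h2, h3⟩
      exact ⟨h2, h3, (ENNReal.ofReal_lt_iff_lt_toReal h2.le hmt).1 h1⟩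
    · rintro ⟨h2, h3, h1⟩
      exact ⟨(ENNReal.ofReal_lt_iff_lt_toReal h2.le hmt).2 h1, h2, h3⟩
  rw [this, Real.volume_Ioo, sub_zero, ENNReal.ofReal_min, ENNReal.ofReal_toReal hmt]

theorem lintegral_decRearr_le [SFinite μ] {g : X → ℝ≥0∞} (hg : AEMeasurable g μ) (s : ℝ)
    {c : ℝ≥0∞} (hc : c ≠ ∞) :
    ∫⁻ τ in Ioo 0 s, decRearr μ g τ ≤ ENNReal.ofReal s * c + ∫⁻ x, (g x - c) ∂μ := by
  calc ∫⁻ τ in Ioo 0 s, decRearr μ g τ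
      ≤ ∫⁻ τ in Ioo 0 s, (c + (decRearr μ g τ - c)) := lintegral_mono fun τ => le_add_tsub
    _ = ENNReal.ofReal s * c + ∫⁻ τ in Ioo 0 s, (decRearr μ g τ - c) := by
        rw [lintegral_add_left measurable_const]
        simp [mul_comm]
    _ ≤ _ := by
        rw [lintegral_decRearr_sub_eq g s c hc, lintegral_sub_eq_lintegral_measure_lt hg c hc]
        gcongr
        exact min_le_right _ _

/-- At the level `c = g^*(s)` the minimum with `s` truncates nothing, since every higher superlevel
set already has measure at most `s`. This is the equality case of `lintegral_decRearr_le`. -/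
theorem le_lintegral_decRearr [SFinite μ] {g : X → ℝ≥0∞} (hg : AEMeasurable g μ) (s : ℝ)
    (hc : decRearr μ g s ≠ ∞) :
    ENNReal.ofReal s * decRearr μ g s + ∫⁻ x, (g x - decRearr μ g s) ∂μ ≤
      ∫⁻ τ in Ioo 0 s, decRearr μ g τ := by
  set c := decRearr μ g s with hcdef
  calc ENNReal.ofReal s * c + ∫⁻ x, (g x - c) ∂μ
      ≤ ENNReal.ofReal s * c + ∫⁻ τ in Ioo 0 s, (decRearr μ g τ - c) := by
        rw [lintegral_decRearr_sub_eq g s c hc, lintegral_sub_eq_lintegral_measure_lt hg c hc]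
        refine add_le_add le_rfl (setLIntegral_mono' measurableSet_Ioi fun l hl =>
          le_min (decRearr_le_iff.1 ?_) le_rfl)
        rw [← hcdef, ← ENNReal.ofReal_toReal hc]
        exact ENNReal.ofReal_le_ofReal (le_of_lt hl)
    _ = ∫⁻ τ in Ioo 0 s, (c + (decRearr μ g τ - c)) := by
        rw [lintegral_add_left measurable_const]
        simp [mul_comm]
    _ = _ := setLIntegral_congr_fun measurableSet_Ioo fun τ hτ =>
        add_tsub_cancel_of_le (antitone_decRearr (μ := μ) g hτ.2.le)

theorem ofReal_mul_decRearr_le_lintegral (g : X → ℝ≥0∞) (s : ℝ) :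
    ENNReal.ofReal s * decRearr μ g s ≤ ∫⁻ τ in Ioo 0 s, decRearr μ g τ := by
  calc ENNReal.ofReal s * decRearr μ g s = ∫⁻ _ in Ioo 0 s, decRearr μ g s := by
        simp [mul_comm]
    _ ≤ _ := setLIntegral_mono' measurableSet_Ioo fun τ hτ => antitone_decRearr (μ := μ) g hτ.2.le

theorem decRearr_ne_top_of_lintegral_ne_top {g : X → ℝ≥0∞} {s : ℝ} (hs : 0 < s)
    (h : ∫⁻ τ in Ioo 0 s, decRearr μ g τ ≠ ∞) : decRearr μ g s ≠ ∞ := by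
  intro h'
  have := ofReal_mul_decRearr_le_lintegral (μ := μ) g s
  rw [h', ENNReal.mul_top (by simpa using hs)] at this
  exact h (top_le_iff.1 this)

theorem rearrangement_eq_decRearr {N : ℕ} (f : Space N → ℝ) (s : ℝ) :
    rearrangement f s = decRearr volume (fun x => ‖f x‖ₑ) s := by
  have hlt : ∀ l : ℝ, 0 ≤ l →
      {x | l < |f x|} = {x | ENNReal.ofReal l < ‖f x‖ₑ} := by
    intro l hl
    ext x
    simp only [mem_ofPred_eq, ← ofReal_norm, Real.norm_eq_abs]
    exact (ENNReal.ofReal_lt_ofReal_iff_of_nonneg hl).symm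
  refine le_antisymm ?_ ?_
  · refine le_of_forall_gt fun c hc => ?_
    obtain ⟨l, hl0, hl, hlc⟩ := ENNReal.lt_iff_exists_real_btwn.1 hc
    have hl' : 0 < l := by
      by_contra h
      simp [ENNReal.ofReal_of_nonpos (not_lt.1 h)] at hl
    refine lt_of_le_of_lt ?_ hlc
    refine iInf_le_of_le l (iInf_le_of_le hl' (iInf_le_of_le ?_ le_rfl))
    rw [distributionFun, hlt l hl0]
    exact decRearr_le_iff.1 hl.le
  · refine le_iInf fun l => le_iInf fun hl => le_iInf fun h => ?_
    rw [decRearr_le_iff, ← hlt l hl.le]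
    exact h

end Rearrangement

/-! ### Slow variation of the weight. -/

namespace IsWeight

variable {Φ : ℝ → ℝ}

theorem one_le (hΦ : IsWeight Φ) {a : ℝ} (ha : 0 ≤ a) : 1 ≤ Φ a :=
  hΦ.map_zero ▸ hΦ.monotoneOn self_mem_Ici ha ha

theorem pos_inv (hΦ : IsWeight Φ) {s : ℝ} (hs : 0 < s) : 0 < Φ s⁻¹ :=
  zero_lt_one.trans_le (hΦ.one_le (inv_nonneg.2 hs.le))

theorem inv_le_inv (hΦ : IsWeight Φ) {s S : ℝ} (hs : 0 < s) (h : s ≤ S) : Φ S⁻¹ ≤ Φ s⁻¹ :=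
  hΦ.monotoneOn (inv_nonneg.2 (hs.le.trans h)) (inv_nonneg.2 hs.le) (inv_anti₀ hs h)

/-- Extends (Φ3) from large arguments to all positive ones, using `1 ≤ Φ ≤ Φ τ` on `[0, τ]`. -/
theorem exists_le_div_rpow_mul (hΦ : IsWeight Φ) {δ : ℝ} (hδ : 0 < δ) :
    ∃ C : ℝ, 1 ≤ C ∧ ∀ a b : ℝ, 0 < a → a ≤ b → Φ b ≤ C * ((b / a) ^ δ * Φ a) := by
  obtain ⟨C, τ, hC, hτ, h⟩ := hΦ.almost_decreasing δ hδ
  have h1 := hΦ.one_le hτ.le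
  have key : ∀ a b : ℝ, τ ≤ a → a ≤ b → Φ b ≤ C * ((b / a) ^ δ * Φ a) := by
    intro a b ha hab
    have ha0 : 0 < a := hτ.trans_le ha
    have hb0 : 0 < b := ha0.trans_le hab
    have hb := Real.rpow_pos_of_pos hb0 δ
    have := mul_le_mul_of_nonneg_left (h a b ha hab) hb.le
    rw [Real.rpow_neg hb0.le, Real.rpow_neg ha0.le, mul_inv_cancel_left₀ hb.ne'] at this
    rw [Real.div_rpow hb0.le ha0.le]
    calc Φ b ≤ _ := this
      _ = _ := by ring
  refine ⟨max 1 C * Φ τ, one_le_mul_of_one_le_of_one_le (le_max_left _ _) h1, ?_⟩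
  intro a b ha hab
  have hb0 : 0 < b := ha.trans_le hab
  have hΦa := hΦ.one_le ha.le
  have hq : 1 ≤ (b / a) ^ δ := Real.one_le_rpow ((one_le_div ha).2 hab) hδ.le
  have hm : 1 ≤ max 1 C := le_max_left _ _
  rcases le_total τ a with hτa | haτ
  · refine (key a b hτa hab).trans ?_
    gcongr
    exact (le_max_right 1 C).trans (le_mul_of_one_le_right (by positivity) h1)
  rcases le_total b τ with hbτ | hτb
  · calc Φ b ≤ Φ τ := hΦ.monotoneOn hb0.le hτ.le hbτ
      _ = (1 * Φ τ) * (1 * 1) := by ring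
      _ ≤ _ := by gcongr
  · calc Φ b ≤ C * ((b / τ) ^ δ * Φ τ) := key τ b le_rfl hτb
      _ ≤ max 1 C * ((b / a) ^ δ * Φ τ) := by
          gcongr
          exact le_max_right _ _
      _ = (max 1 C * Φ τ) * ((b / a) ^ δ * 1) := by ring
      _ ≤ _ := by gcongr

/-- `s ^ ε Φ(s⁻¹) ^ γ` is almost increasing in `s`. -/
theorem exists_rpow_mul_le (hΦ : IsWeight Φ) {ε : ℝ} (hε : 0 < ε) (γ : ℝ) :
    ∃ C : ℝ, 0 < C ∧ ∀ s S : ℝ, 0 < s → s ≤ S →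
      s ^ ε * Φ s⁻¹ ^ γ ≤ C * (S ^ ε * Φ S⁻¹ ^ γ) := by
  rcases le_or_gt γ 0 with hγ | hγ
  · refine ⟨1, one_pos, fun s S hs h => ?_⟩
    rw [one_mul]
    have hS := hs.trans_le h
    have h1 := hΦ.pos_inv hs
    have h3 := Real.rpow_le_rpow_of_nonpos (hΦ.pos_inv hS) (hΦ.inv_le_inv hs h) hγ
    gcongr
  -- With `δ = ε / γ`, raising to the power `γ` produces exactly `(S / s) ^ ε`.
  · obtain ⟨C, hC, h⟩ := hΦ.exists_le_div_rpow_mul (div_pos hε hγ)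
    refine ⟨C ^ γ, by positivity, fun s S hs hsS => ?_⟩
    have hS := hs.trans_le hsS
    have h1 := hΦ.pos_inv hs
    have h2 := hΦ.pos_inv hS
    have := h S⁻¹ s⁻¹ (inv_pos.2 hS) (inv_anti₀ hs hsS)
    calc s ^ ε * Φ s⁻¹ ^ γ
        ≤ s ^ ε * (C * ((s⁻¹ / S⁻¹) ^ (ε / γ) * Φ S⁻¹)) ^ γ := by gcongr
      _ = s ^ ε * (C ^ γ * ((S / s) ^ ε * Φ S⁻¹ ^ γ)) := by
          rw [show s⁻¹ / S⁻¹ = S / s by field_simp, Real.mul_rpow (by positivity) (by positivity),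
            Real.mul_rpow (by positivity) (by positivity), ← Real.rpow_mul (by positivity),
            div_mul_cancel₀ _ hγ.ne']
      _ = _ := by
          rw [Real.div_rpow hS.le hs.le]
          field_simp

/-- `s ^ (-ε) Φ(s⁻¹) ^ γ` is almost decreasing in `s`. -/
theorem exists_rpow_neg_mul_le (hΦ : IsWeight Φ) {ε : ℝ} (hε : 0 < ε) (γ : ℝ) :
    ∃ C : ℝ, 0 < C ∧ ∀ s S : ℝ, 0 < s → s ≤ S →
      S ^ (-ε) * Φ S⁻¹ ^ γ ≤ C * (s ^ (-ε) * Φ s⁻¹ ^ γ) := by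
  obtain ⟨C, hC, h⟩ := hΦ.exists_rpow_mul_le hε (-γ)
  refine ⟨C, hC, fun s S hs hsS => ?_⟩
  have hS := hs.trans_le hsS
  have h1 := hΦ.pos_inv hs
  have h2 := hΦ.pos_inv hS
  have := h s S hs hsS
  rw [Real.rpow_neg h1.le, Real.rpow_neg h2.le] at this
  rw [Real.rpow_neg hs.le, Real.rpow_neg hS.le]
  have e1 := Real.rpow_pos_of_pos h1 γ
  have e2 := Real.rpow_pos_of_pos h2 γ
  have e3 := Real.rpow_pos_of_pos hs ε
  have e4 := Real.rpow_pos_of_pos hS ε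
  generalize Φ s⁻¹ ^ γ = A at *
  generalize Φ S⁻¹ ^ γ = B at *
  field_simp at this ⊢
  linarith

/-- Iterate (Φ2) `n` times with `2 ^ n > κ`; for `a ≤ 1` the bound `Φ 1` suffices. -/
theorem exists_map_rpow_le (hΦ : IsWeight Φ) {κ : ℝ} (hκ : 0 < κ) :
    ∃ C : ℝ, 1 ≤ C ∧ ∀ a : ℝ, 0 < a → Φ (a ^ κ) ≤ C * Φ a := by
  obtain ⟨C, hC, h⟩ := hΦ.map_sq_le
  have hpow : ∀ (n : ℕ) (a : ℝ), 0 ≤ a → Φ (a ^ (2 ^ n)) ≤ C ^ n * Φ a := by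
    intro n
    induction n with
    | zero => simp
    | succ n ih =>
      intro a ha
      calc Φ (a ^ (2 ^ (n + 1))) = Φ ((a ^ (2 ^ n)) ^ 2) := by rw [← pow_mul, pow_succ]
        _ ≤ C * Φ (a ^ (2 ^ n)) := h _ (by positivity)
        _ ≤ C * (C ^ n * Φ a) := by gcongr; exact ih a ha
        _ = _ := by ring
  obtain ⟨n, hn⟩ := pow_unbounded_of_one_lt κ (one_lt_two : (1 : ℝ) < 2)
  have h1 := hΦ.one_le zero_le_one
  refine ⟨max (Φ 1) (C ^ n), h1.trans (le_max_left _ _), fun a ha => ?_⟩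
  have hΦa := hΦ.one_le ha.le
  rcases le_total a 1 with ha1 | ha1
  · calc Φ (a ^ κ) ≤ Φ 1 := hΦ.monotoneOn (Real.rpow_nonneg ha.le _) (mem_Ici.2 zero_le_one)
          (Real.rpow_le_one ha.le ha1 hκ.le)
      _ = Φ 1 * 1 := by ring
      _ ≤ _ := by gcongr; exact le_max_left _ _
  · calc Φ (a ^ κ) ≤ Φ (a ^ (2 ^ n)) := by
          refine hΦ.monotoneOn (Real.rpow_nonneg ha.le _) (pow_nonneg ha.le _) ?_
          rw [← Real.rpow_natCast]
          exact Real.rpow_le_rpow_of_exponent_le ha1 (by exact_mod_cast hn.le)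
      _ ≤ C ^ n * Φ a := hpow n a ha.le
      _ ≤ _ := by gcongr; exact le_max_right _ _

theorem exists_inv_rpow_rpow_le (hΦ : IsWeight Φ) {κ : ℝ} (hκ : 0 < κ) (γ : ℝ) :
    ∃ C : ℝ, 0 < C ∧ ∀ t : ℝ, 0 < t → Φ (t ^ κ)⁻¹ ^ γ ≤ C * Φ t⁻¹ ^ γ := by
  rcases le_total 0 γ with hγ | hγ
  · obtain ⟨C, hC, h⟩ := hΦ.exists_map_rpow_le hκ
    refine ⟨C ^ γ, by positivity, fun t ht => ?_⟩
    have h1 := hΦ.pos_inv ht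
    have h2 := hΦ.pos_inv (Real.rpow_pos_of_pos ht κ)
    rw [← Real.mul_rpow (by positivity) h1.le]
    refine Real.rpow_le_rpow h2.le ?_ hγ
    rw [← Real.inv_rpow ht.le]
    exact h _ (inv_pos.2 ht)
  -- A negative exponent needs a lower bound for `Φ (t ^ κ)⁻¹`, which comes from the exponent `κ⁻¹`
  -- applied at `(t ^ κ)⁻¹`.
  · obtain ⟨C, hC, h⟩ := hΦ.exists_map_rpow_le (inv_pos.2 hκ)
    refine ⟨C ^ (-γ), by positivity, fun t ht => ?_⟩
    have h1 := hΦ.pos_inv ht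
    have h2 := hΦ.pos_inv (Real.rpow_pos_of_pos ht κ)
    have h3 := h (t ^ κ)⁻¹ (by positivity)
    rw [← Real.inv_rpow ht.le, Real.rpow_rpow_inv (by positivity) hκ.ne', Real.inv_rpow ht.le] at h3
    have h4 := Real.rpow_le_rpow_of_nonpos h1 h3 hγ
    rw [Real.mul_rpow (by positivity) h2.le] at h4
    calc Φ (t ^ κ)⁻¹ ^ γ = C ^ (-γ) * (C ^ γ * Φ (t ^ κ)⁻¹ ^ γ) := by
          rw [← mul_assoc, ← Real.rpow_add (by positivity)]
          simp
      _ ≤ _ := by gcongr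

theorem exists_lintegral_Ioo_le (hΦ : IsWeight Φ) {a : ℝ} (ha : a < 1) (b : ℝ) :
    ∃ C : ℝ, 0 < C ∧ ∀ s : ℝ, 0 < s →
      ∫⁻ τ in Ioo 0 s, ENNReal.ofReal (τ ^ (-a) * Φ τ⁻¹ ^ b) ≤
        ENNReal.ofReal (C * (s ^ (1 - a) * Φ s⁻¹ ^ b)) := by
  -- Half of the gap to `1` absorbs the weight; the other half keeps the remaining power integrable
  -- at `0`.
  set ε := (1 - a) / 2 with hεdef
  have hε : 0 < ε := by linarith
  obtain ⟨C, hC, h⟩ := hΦ.exists_rpow_mul_le hε b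
  refine ⟨C / ε, by positivity, fun s hs => ?_⟩
  have hΦs := hΦ.pos_inv hs
  have hexp : -1 < -a - ε := by linarith
  have hint : IntegrableOn (fun τ : ℝ => τ ^ (-a - ε) * (C * (s ^ ε * Φ s⁻¹ ^ b))) (Ioo 0 s) :=
    Integrable.mul_const ((intervalIntegral.integrableOn_Ioo_rpow_iff hs).2 hexp) _
  calc ∫⁻ τ in Ioo 0 s, ENNReal.ofReal (τ ^ (-a) * Φ τ⁻¹ ^ b)
      ≤ ∫⁻ τ in Ioo 0 s, ENNReal.ofReal (τ ^ (-a - ε) * (C * (s ^ ε * Φ s⁻¹ ^ b))) := by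
        refine setLIntegral_mono' measurableSet_Ioo fun τ hτ => ENNReal.ofReal_le_ofReal ?_
        have hτ0 := hτ.1
        have hΦτ := hΦ.pos_inv hτ0
        calc τ ^ (-a) * Φ τ⁻¹ ^ b = τ ^ (-a - ε) * (τ ^ ε * Φ τ⁻¹ ^ b) := by
              rw [← mul_assoc, ← Real.rpow_add hτ0]
              ring_nf
          _ ≤ _ := mul_le_mul_of_nonneg_left (h τ s hτ.1 hτ.2.le) (by positivity)
    _ = ENNReal.ofReal (∫ τ in Ioo 0 s, τ ^ (-a - ε) * (C * (s ^ ε * Φ s⁻¹ ^ b))) := by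
        refine (ofReal_integral_eq_lintegral_ofReal hint ?_).symm
        filter_upwards [self_mem_ae_restrict measurableSet_Ioo] with τ hτ
        have := hτ.1
        positivity
    _ = _ := by
        congr 1
        rw [integral_mul_const, ← integral_Ioc_eq_integral_Ioo,
          ← intervalIntegral.integral_of_le hs.le, integral_rpow (Or.inl hexp),
          Real.zero_rpow (by linarith), show -a - ε + 1 = ε by linarith,
          show 1 - a = ε + ε by linarith, Real.rpow_add hs]
        field_simp
        ring

theorem exists_lintegral_Ioi_le (hΦ : IsWeight Φ) {a : ℝ} (ha : 1 < a) (b : ℝ) :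
    ∃ C : ℝ, 0 < C ∧ ∀ s : ℝ, 0 < s →
      ∫⁻ τ in Ioi s, ENNReal.ofReal (τ ^ (-a) * Φ τ⁻¹ ^ b) ≤
        ENNReal.ofReal (C * (s ^ (1 - a) * Φ s⁻¹ ^ b)) := by
  set ε := (a - 1) / 2 with hεdef
  have hε : 0 < ε := by linarith
  obtain ⟨C, hC, h⟩ := hΦ.exists_rpow_neg_mul_le hε b
  refine ⟨C / ε, by positivity, fun s hs => ?_⟩
  have hΦs := hΦ.pos_inv hs
  have hexp : -a + ε < -1 := by linarith
  have hint : IntegrableOn (fun τ : ℝ => τ ^ (-a + ε) * (C * (s ^ (-ε) * Φ s⁻¹ ^ b))) (Ioi s) :=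
    Integrable.mul_const (integrableOn_Ioi_rpow_of_lt hexp hs) _
  calc ∫⁻ τ in Ioi s, ENNReal.ofReal (τ ^ (-a) * Φ τ⁻¹ ^ b)
      ≤ ∫⁻ τ in Ioi s, ENNReal.ofReal (τ ^ (-a + ε) * (C * (s ^ (-ε) * Φ s⁻¹ ^ b))) := by
        refine setLIntegral_mono' measurableSet_Ioi fun τ hτ => ENNReal.ofReal_le_ofReal ?_
        have hτ0 : 0 < τ := hs.trans hτ
        have hΦτ := hΦ.pos_inv hτ0
        calc τ ^ (-a) * Φ τ⁻¹ ^ b = τ ^ (-a + ε) * (τ ^ (-ε) * Φ τ⁻¹ ^ b) := by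
              rw [← mul_assoc, ← Real.rpow_add hτ0]
              ring_nf
          _ ≤ _ := mul_le_mul_of_nonneg_left (h s τ hs (le_of_lt hτ)) (by positivity)
    _ = ENNReal.ofReal (∫ τ in Ioi s, τ ^ (-a + ε) * (C * (s ^ (-ε) * Φ s⁻¹ ^ b))) := by
        refine (ofReal_integral_eq_lintegral_ofReal hint ?_).symm
        filter_upwards [self_mem_ae_restrict measurableSet_Ioi] with τ hτ
        have : 0 < τ := hs.trans hτ
        positivity
    _ = _ := by
        congr 1
        rw [integral_mul_const, integral_Ioi_rpow_of_lt hexp hs,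
          show -a + ε + 1 = -ε by linarith,
          show 1 - a = -ε + -ε by linarith, Real.rpow_add hs]
        field_simp

end IsWeight

/-! ### Convolution with a kernel of mass one. -/

section Kernel

variable {N : ℕ}

/-- Convolution of `[0,∞]`-valued functions on `ℝ^N`. -/
def kernelMean (k g : Space N → ℝ≥0∞) (x : Space N) : ℝ≥0∞ :=
  ∫⁻ y, k (x - y) * g y

theorem aemeasurable_prod_kernel {k g : Space N → ℝ≥0∞} (hk : Measurable k)
    (hg : AEMeasurable g volume) :
    AEMeasurable (fun p : Space N × Space N => k (p.1 - p.2) * g p.2)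
      (volume.prod volume) :=
  (hk.comp (measurable_fst.sub measurable_snd)).aemeasurable.mul hg.comp_snd

theorem aemeasurable_kernelMean {k g : Space N → ℝ≥0∞} (hk : Measurable k)
    (hg : AEMeasurable g volume) : AEMeasurable (kernelMean k g) volume :=
  (aemeasurable_prod_kernel hk hg).lintegral_prod_right'

theorem lintegral_kernelMean {k g : Space N → ℝ≥0∞} (hk : Measurable k)
    (hk1 : ∫⁻ x, k x = 1) (hg : AEMeasurable g volume) :
    ∫⁻ x, kernelMean k g x = ∫⁻ y, g y := by
  unfold kernelMean
  rw [lintegral_lintegral_swap (aemeasurable_prod_kernel hk hg)]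
  refine lintegral_congr fun y => ?_
  have hm : Measurable fun x => k (x - y) := hk.comp (measurable_id.sub_const y)
  rw [lintegral_mul_const _ hm, lintegral_sub_right_eq_self k y, hk1, one_mul]

theorem lintegral_kernel_sub {k : Space N → ℝ≥0∞} (hk1 : ∫⁻ x, k x = 1) (x : Space N) :
    ∫⁻ y, k (x - y) = 1 := by
  rw [lintegral_sub_left_eq_self k x, hk1]

theorem kernelMean_le {k : Space N → ℝ≥0∞} (hk : Measurable k) (hk1 : ∫⁻ x, k x = 1)
    (g : Space N → ℝ≥0∞) (c : ℝ≥0∞) (x : Space N) :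
    kernelMean k g x ≤ c + kernelMean k (fun y => g y - c) x := by
  have hm : Measurable fun y => k (x - y) := hk.comp (measurable_id.const_sub x)
  calc kernelMean k g x ≤ ∫⁻ y, (k (x - y) * c + k (x - y) * (g y - c)) := by
        refine lintegral_mono fun y => ?_
        rw [← mul_add]
        gcongr
        exact le_add_tsub
    _ = _ := by
        rw [lintegral_add_left (hm.mul_const c), lintegral_mul_const _ hm,
          lintegral_kernel_sub hk1, one_mul, kernelMean]

/-- With `c = g^*(s)`, the excess of `k ∗ g` over `c` is at most `k ∗ (g - c)_+`, whose integral is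
that of `(g - c)_+`. -/
theorem lintegral_decRearr_kernelMean_le {k g : Space N → ℝ≥0∞} (hk : Measurable k)
    (hk1 : ∫⁻ x, k x = 1) (hg : AEMeasurable g volume) {s : ℝ} (hs : 0 < s) :
    ∫⁻ τ in Ioo 0 s, decRearr volume (kernelMean k g) τ ≤
      ∫⁻ τ in Ioo 0 s, decRearr volume g τ := by
  by_cases h : ∫⁻ τ in Ioo 0 s, decRearr volume g τ = ∞
  · simp [h]
  have hc := decRearr_ne_top_of_lintegral_ne_top hs h
  refine (lintegral_decRearr_le (aemeasurable_kernelMean hk hg) s hc).trans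
    (le_trans ?_ (le_lintegral_decRearr hg s hc))
  refine add_le_add le_rfl ?_
  rw [← lintegral_kernelMean (g := fun y => g y - decRearr volume g s) hk hk1
    (hg.sub aemeasurable_const)]
  exact lintegral_mono fun x => tsub_le_iff_left.2 (kernelMean_le hk hk1 g _ x)

/-- Split `g` at `c = g^*(T)`: the bounded part contributes at most `c` by mass one, the excess at
most `T⁻¹ ∫ (g - c)_+` by the sup bound. -/
theorem ofReal_mul_kernelMean_le {k g : Space N → ℝ≥0∞} (hk : Measurable k)
    (hk1 : ∫⁻ x, k x = 1) (hg : AEMeasurable g volume) {T : ℝ} (hT : 0 < T)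
    (hkT : ∀ x, k x ≤ (ENNReal.ofReal T)⁻¹) (x : Space N) :
    ENNReal.ofReal T * kernelMean k g x ≤ ∫⁻ τ in Ioo 0 T, decRearr volume g τ := by
  by_cases h : ∫⁻ τ in Ioo 0 T, decRearr volume g τ = ∞
  · simp [h]
  have hc := decRearr_ne_top_of_lintegral_ne_top hT h
  refine le_trans ?_ (le_lintegral_decRearr hg T hc)
  set c := decRearr volume g T
  have hT0 : ENNReal.ofReal T ≠ 0 := by simpa using hT
  calc ENNReal.ofReal T * kernelMean k g x
      ≤ ENNReal.ofReal T * (c + ∫⁻ y, (ENNReal.ofReal T)⁻¹ * (g y - c)) := by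
        gcongr
        refine (kernelMean_le hk hk1 g c x).trans ?_
        unfold kernelMean
        gcongr
        exact hkT _
    _ = _ := by
        rw [lintegral_const_mul' _ _ (by simpa using hT), mul_add, ← mul_assoc,
          ENNReal.mul_inv_cancel hT0 ENNReal.ofReal_ne_top, one_mul]

/-- Jensen, in the form of monotonicity of `L^p` norms for the probability measure of density `k (x
- ·)`. -/
theorem kernelMean_rpow_le {k g : Space N → ℝ≥0∞} (hk : Measurable k)
    (hk1 : ∫⁻ x, k x = 1) (hg : AEMeasurable g volume) {r : ℝ} (hr : 1 ≤ r) (x : Space N) :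
    kernelMean k g x ^ r ≤ kernelMean k (fun y => g y ^ r) x := by
  have hm : Measurable fun y => k (x - y) := hk.comp (measurable_id.const_sub x)
  set ν : Measure (Space N) := volume.withDensity fun y => k (x - y)
  have : IsProbabilityMeasure ν := ⟨by
    rw [withDensity_apply _ MeasurableSet.univ, Measure.restrict_univ, lintegral_kernel_sub hk1]⟩
  have hν : ∀ f : Space N → ℝ≥0∞, AEMeasurable f volume →
      kernelMean k f x = ∫⁻ y, f y ∂ν := fun f hf =>
    (lintegral_withDensity_eq_lintegral_mul₀ hm.aemeasurable hf).symm
  have hr0 : 0 < r := zero_lt_one.trans_le hr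
  have hgν : AEMeasurable g ν := hg.mono_ac (withDensity_absolutelyContinuous _ _)
  have h := eLpNorm'_le_eLpNorm'_of_exponent_le (μ := ν) zero_lt_one hr hgν.aestronglyMeasurable
  rw [hν g hg, hν _ (hg.pow_const r), ← ENNReal.le_rpow_inv_iff hr0]
  simpa [eLpNorm'] using h

end Kernel

/-! ### The Gauss kernel, absolute convergence and measurability. -/

section Gauss

variable {N : ℕ}

theorem gaussKernel_nonneg {t : ℝ} (ht : 0 < t) (x : Space N) : 0 ≤ gaussKernel N t x := by
  unfold gaussKernel
  positivity

theorem continuous_gaussKernel (N : ℕ) (t : ℝ) : Continuous (gaussKernel N t) := by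
  unfold gaussKernel
  fun_prop

theorem integrable_gaussKernel {t : ℝ} (ht : 0 < t) : Integrable (gaussKernel N t) volume := by
  have h := (GaussianFourier.integrable_cexp_neg_mul_sq_norm_add (V := Space N)
    (b := ((1 / (4 * t) : ℝ) : ℂ)) (by simpa using ht) 0 0).norm
  refine (h.const_mul ((4 * Real.pi * t) ^ (-(N : ℝ) / 2))).congr (ae_of_all _ fun x => ?_)
  simp only [gaussKernel, Complex.norm_exp]
  congr 2
  simp [← Complex.ofReal_pow]
  norm_cast
  ring

theorem integral_gaussKernel {t : ℝ} (ht : 0 < t) : ∫ x, gaussKernel N t x = 1 := by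
  have h := GaussianFourier.integral_rexp_neg_mul_sq_norm (V := Space N)
    (b := 1 / (4 * t)) (by positivity)
  simp only [gaussKernel]
  rw [integral_const_mul]
  have : ∀ x : Space N, Real.exp (-‖x‖ ^ 2 / (4 * t)) = Real.exp (-(1 / (4 * t)) * ‖x‖ ^ 2) :=
    fun x => by ring_nf
  simp_rw [this]
  rw [h, finrank_euclideanSpace_fin, show Real.pi / (1 / (4 * t)) = 4 * Real.pi * t by
    field_simp, ← Real.rpow_add (by positivity)]
  simp [neg_div]

/-- The Gauss kernel as a function with values in `[0,∞]`. -/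
def egauss (N : ℕ) (t : ℝ) (x : Space N) : ℝ≥0∞ := ENNReal.ofReal (gaussKernel N t x)

theorem measurable_egauss (N : ℕ) (t : ℝ) : Measurable (egauss N t) :=
  ENNReal.measurable_ofReal.comp (continuous_gaussKernel N t).measurable

theorem lintegral_egauss {t : ℝ} (ht : 0 < t) : ∫⁻ x, egauss N t x = 1 := by
  unfold egauss
  rw [← ofReal_integral_eq_lintegral_ofReal (integrable_gaussKernel ht)
    (ae_of_all _ (gaussKernel_nonneg ht)), integral_gaussKernel ht, ENNReal.ofReal_one]

theorem egauss_le {t : ℝ} (ht : 0 < t) (x : Space N) :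
    egauss N t x ≤ (ENNReal.ofReal (t ^ ((N : ℝ) / 2)))⁻¹ := by
  rw [← ENNReal.ofReal_inv_of_pos (by positivity), egauss, ← Real.rpow_neg ht.le]
  refine ENNReal.ofReal_le_ofReal ?_
  calc gaussKernel N t x ≤ (4 * Real.pi * t) ^ (-(N : ℝ) / 2) * 1 := by
        unfold gaussKernel
        gcongr
        refine Real.exp_le_one_iff.2 (div_nonpos_of_nonpos_of_nonneg ?_ (by positivity))
        simp
    _ ≤ t ^ (-((N : ℝ) / 2)) := by
        rw [mul_one, neg_div]
        refine Real.rpow_le_rpow_of_nonpos ht ?_ (by simp; positivity)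
        nlinarith [Real.pi_gt_three]

theorem enorm_gaussKernel_mul {t : ℝ} (ht : 0 < t) (φ : Space N → ℝ) (x y : Space N) :
    ‖gaussKernel N t (x - y) * φ y‖ₑ = egauss N t (x - y) * ‖φ y‖ₑ := by
  rw [enorm_mul, Real.enorm_of_nonneg (gaussKernel_nonneg ht _), egauss]

theorem enorm_heatSemigroup_le {t : ℝ} (ht : 0 < t) (φ : Space N → ℝ) (x : Space N) :
    ‖heatSemigroup N t φ x‖ₑ ≤ kernelMean (egauss N t) (fun y => ‖φ y‖ₑ) x := by
  refine (enorm_integral_le_lintegral_enorm _).trans_eq ?_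
  simp_rw [enorm_gaussKernel_mul ht]
  rfl

theorem heatIntegrable_of_kernelMean_ne_top {t : ℝ} (ht : 0 < t) {φ : Space N → ℝ}
    (hφ : AEStronglyMeasurable φ volume)
    (h : ∀ x, kernelMean (egauss N t) (fun y => ‖φ y‖ₑ) x ≠ ∞) : HeatIntegrable N t φ := by
  intro x
  refine ⟨((continuous_gaussKernel N t).comp (continuous_const.sub continuous_id)
    |>.aestronglyMeasurable).mul hφ, ?_⟩
  rw [HasFiniteIntegral]
  simp_rw [enorm_gaussKernel_mul ht]
  exact (h x).lt_top

theorem aestronglyMeasurable_heatSemigroup (t : ℝ) {φ : Space N → ℝ}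
    (hφ : AEStronglyMeasurable φ volume) :
    AEStronglyMeasurable (heatSemigroup N t φ) volume := by
  have : AEStronglyMeasurable
      (fun p : Space N × Space N => gaussKernel N t (p.1 - p.2) * φ p.2)
      (volume.prod volume) :=
    ((continuous_gaussKernel N t).comp
      (continuous_fst.sub continuous_snd)).aestronglyMeasurable.mul hφ.comp_snd
  exact this.integral_prod_right'

theorem locallyIntegrable_of_enorm_le {u : Space N → ℝ} (hu : AEStronglyMeasurable u volume)
    {b : ℝ≥0∞} (hb : b ≠ ∞) (h : ∀ x, ‖u x‖ₑ ≤ b) : LocallyIntegrable u volume := by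
  have : MemLp u ∞ volume := ⟨hu, by
    rw [eLpNorm_exponent_top]
    exact (eLpNormEssSup_le_of_ae_enorm_bound (ae_of_all _ h)).trans_lt hb.lt_top⟩
  exact this.locallyIntegrable le_top

end Gauss

/-! ### Norm bounds rewritten as bounds on rearrangements. -/

section Norms

variable {N : ℕ} {Φ : ℝ → ℝ} {r : ℝ≥0∞} {α : ℝ}

/-- Solving for the rearrangement at each `s` exposes the profile `s^{-1/r} Φ(1/s)^{-α/r}`, with
which all later estimates are compared. -/
theorem weakNorm_le_iff (hΦ : IsWeight Φ) (hr : 1 ≤ r) (hrt : r ≠ ∞) {u : Space N → ℝ}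
    {B : ℝ≥0∞} : weakNorm Φ r α u ≤ B ↔ ∀ s : ℝ, 0 < s →
      decRearr volume (fun x => ‖u x‖ₑ) s ≤
        B * ENNReal.ofReal (s ^ (-(r⁻¹).toReal) * Φ s⁻¹ ^ (-α * (r⁻¹).toReal)) := by
  have hρ : 0 < r.toReal := ENNReal.toReal_pos (zero_lt_one.trans_le hr).ne' hrt
  rw [weakNorm, if_neg hrt, iSup₂_le_iff]
  refine forall_congr' fun s => forall_congr' fun hs => ?_
  have hp := hΦ.pos_inv hs
  set z : ℝ := s ^ (-(r⁻¹).toReal) * Φ s⁻¹ ^ (-α * (r⁻¹).toReal) with hz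
  have hz0 : 0 < z := by positivity
  have hzinv : z⁻¹ = (s * Φ s⁻¹ ^ α) ^ (1 / r.toReal) := by
    rw [Real.mul_rpow hs.le (by positivity), ← Real.rpow_mul hp.le, hz, ENNReal.toReal_inv,
      mul_inv, ← Real.rpow_neg hs.le, ← Real.rpow_neg hp.le]
    simp [div_eq_mul_inv]
  rw [rearrangement_eq_decRearr, ← ENNReal.ofReal_mul hs.le,
    ENNReal.mul_rpow_of_nonneg _ _ (by positivity), ← ENNReal.rpow_mul,
    mul_one_div_cancel hρ.ne', ENNReal.rpow_one, ENNReal.ofReal_rpow_of_pos (by positivity),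
    ← hzinv, ENNReal.mul_le_iff_le_inv (by simpa using hz0) ENNReal.ofReal_ne_top,
    ← ENNReal.ofReal_inv_of_pos (inv_pos.2 hz0), inv_inv, mul_comm]

theorem strongNorm_le_iff (hΦ : IsWeight Φ) (hr : 1 ≤ r) (hrt : r ≠ ∞) {u : Space N → ℝ}
    {B : ℝ≥0∞} : strongNorm Φ r α u ≤ B ↔ ∀ s : ℝ, 0 < s →
      ∫⁻ τ in Ioo 0 s, decRearr volume (fun x => ‖u x‖ₑ) τ ^ r.toReal ≤
        B ^ r.toReal * ENNReal.ofReal (Φ s⁻¹ ^ (-α)) := by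
  have hρ : 0 < r.toReal := ENNReal.toReal_pos (zero_lt_one.trans_le hr).ne' hrt
  rw [strongNorm, if_neg hrt, iSup₂_le_iff]
  refine forall_congr' fun s => forall_congr' fun hs => ?_
  have hp := hΦ.pos_inv hs
  have hs0 : ENNReal.ofReal s ≠ 0 := by simpa using hs
  have hy : 0 < Φ s⁻¹ ^ α := by positivity
  have hre : ∀ τ, rearrangement (fun x => |u x| ^ r.toReal) τ =
      decRearr volume (fun x => ‖u x‖ₑ) τ ^ r.toReal := by
    intro τ
    rw [rearrangement_eq_decRearr, ← decRearr_rpow _ hρ]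
    congr 1
    funext x
    rw [Real.enorm_rpow_of_nonneg (abs_nonneg _) hρ.le]
    simp
  simp_rw [averagedRearrangement, hre]
  rw [mul_comm (ENNReal.ofReal s), mul_assoc, ENNReal.mul_inv_cancel_left hs0 ENNReal.ofReal_ne_top,
    one_div, ENNReal.rpow_inv_le_iff hρ,
    ENNReal.mul_le_iff_le_inv (by simpa using hy) ENNReal.ofReal_ne_top,
    ← ENNReal.ofReal_inv_of_pos hy, ← Real.rpow_neg hp.le, mul_comm]

theorem rpow_weight_rpow (hΦ : IsWeight Φ) (hr : 1 ≤ r) (hrt : r ≠ ∞) {s : ℝ} (hs : 0 < s) :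
    (s ^ (-(r⁻¹).toReal) * Φ s⁻¹ ^ (-α * (r⁻¹).toReal)) ^ r.toReal = s⁻¹ * Φ s⁻¹ ^ (-α) := by
  have hρ : 0 < r.toReal := ENNReal.toReal_pos (zero_lt_one.trans_le hr).ne' hrt
  have hp := hΦ.pos_inv hs
  rw [Real.mul_rpow (by positivity) (by positivity), ← Real.rpow_mul hs.le, ← Real.rpow_mul hp.le,
    ENNReal.toReal_inv, neg_mul, inv_mul_cancel₀ hρ.ne', mul_assoc, inv_mul_cancel₀ hρ.ne',
    mul_one, Real.rpow_neg_one]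

theorem le_mul_ofReal_weight_of_rpow_le (hΦ : IsWeight Φ) (hr : 1 ≤ r) (hrt : r ≠ ∞) {s : ℝ}
    (hs : 0 < s) {x B : ℝ≥0∞}
    (h : ENNReal.ofReal s * x ^ r.toReal ≤ B ^ r.toReal * ENNReal.ofReal (Φ s⁻¹ ^ (-α))) :
    x ≤ B * ENNReal.ofReal (s ^ (-(r⁻¹).toReal) * Φ s⁻¹ ^ (-α * (r⁻¹).toReal)) := by
  have hρ : 0 < r.toReal := ENNReal.toReal_pos (zero_lt_one.trans_le hr).ne' hrt
  have hp := hΦ.pos_inv hs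
  rw [← ENNReal.rpow_le_rpow_iff hρ, ENNReal.mul_rpow_of_nonneg _ _ hρ.le,
    ENNReal.ofReal_rpow_of_pos (by positivity), rpow_weight_rpow hΦ hr hrt hs,
    ENNReal.ofReal_mul (by positivity), ENNReal.ofReal_inv_of_pos hs, mul_left_comm,
    ← ENNReal.mul_le_iff_le_inv (by simpa using hs) ENNReal.ofReal_ne_top]
  exact h

theorem weakNorm_le_strongNorm (hΦ : IsWeight Φ) (hr : 1 ≤ r) (u : Space N → ℝ) :
    weakNorm Φ r α u ≤ strongNorm Φ r α u := by
  by_cases hrt : r = ∞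
  · simp [weakNorm, strongNorm, hrt]
  have hρ : 0 < r.toReal := ENNReal.toReal_pos (zero_lt_one.trans_le hr).ne' hrt
  rw [weakNorm_le_iff hΦ hr hrt]
  intro s hs
  refine le_mul_ofReal_weight_of_rpow_le hΦ hr hrt hs
    (le_trans ?_ ((strongNorm_le_iff hΦ hr hrt).1 le_rfl s hs))
  simp_rw [← decRearr_rpow _ hρ]
  exact ofReal_mul_decRearr_le_lintegral _ s

theorem strongNorm_top_le {u : Space N → ℝ} {b : ℝ≥0∞} (h : ∀ x, ‖u x‖ₑ ≤ b) :
    strongNorm Φ ∞ α u ≤ b := by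
  rw [strongNorm, if_pos rfl, eLpNorm_exponent_top]
  exact eLpNormEssSup_le_of_ae_enorm_bound (ae_of_all _ h)

end Norms

/-! ### Norm stability and sup bounds for the heat flow. -/

section HeatBounds

variable {N : ℕ} {Φ : ℝ → ℝ} {r : ℝ≥0∞} {α : ℝ}

theorem kernelMean_le_eLpNorm_top {t : ℝ} (ht : 0 < t) (φ : Space N → ℝ) (x : Space N) :
    kernelMean (egauss N t) (fun y => ‖φ y‖ₑ) x ≤ eLpNorm φ ∞ volume := by
  calc kernelMean (egauss N t) (fun y => ‖φ y‖ₑ) x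
      ≤ ∫⁻ y, egauss N t (x - y) * eLpNorm φ ∞ volume := by
        refine lintegral_mono_ae ?_
        filter_upwards [enorm_ae_le_eLpNormEssSup φ volume] with y hy
        rw [eLpNorm_exponent_top]
        gcongr
    _ = _ := by
        have hm : Measurable fun y => egauss N t (x - y) :=
          (measurable_egauss N t).comp (measurable_id.const_sub x)
        rw [lintegral_mul_const _ hm, lintegral_kernel_sub (lintegral_egauss ht), one_mul]

/-- By Jensen `|S(t)φ|^r ≤ S(t)|φ|^r`, and averaging does not increase `∫_0^s` of the rearrangement;
hence the constant is one. -/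
theorem strongNorm_heatSemigroup_le (hΦ : IsWeight Φ) (hr : 1 ≤ r) {t : ℝ} (ht : 0 < t)
    {φ : Space N → ℝ} (hφ : AEStronglyMeasurable φ volume) :
    strongNorm Φ r α (heatSemigroup N t φ) ≤ strongNorm Φ r α φ := by
  rcases eq_or_ne r ∞ with rfl | hrt
  · refine strongNorm_top_le fun x => (enorm_heatSemigroup_le ht φ x).trans ?_
    rw [strongNorm, if_pos rfl]
    exact kernelMean_le_eLpNorm_top ht φ x
  have hρ : 0 < r.toReal := ENNReal.toReal_pos (zero_lt_one.trans_le hr).ne' hrt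
  have hρ1 : 1 ≤ r.toReal := ENNReal.toReal_one ▸ ENNReal.toReal_mono hrt hr
  rw [strongNorm_le_iff hΦ hr hrt]
  intro s hs
  refine le_trans ?_ ((strongNorm_le_iff hΦ hr hrt).1 le_rfl s hs)
  simp_rw [← decRearr_rpow _ hρ]
  refine le_trans (lintegral_mono fun τ => ?_)
    (lintegral_decRearr_kernelMean_le (measurable_egauss N t) (lintegral_egauss ht)
      (hφ.enorm.pow_const _) hs)
  refine decRearr_mono (fun x => ?_) τ
  refine le_trans ?_ (kernelMean_rpow_le (measurable_egauss N t) (lintegral_egauss ht)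
    hφ.enorm hρ1 x)
  gcongr
  exact enorm_heatSemigroup_le ht φ x

theorem kernelMean_le_strongNorm (hΦ : IsWeight Φ) (hr : 1 ≤ r) {t : ℝ} (ht : 0 < t)
    {φ : Space N → ℝ} (hφ : AEStronglyMeasurable φ volume) {T : ℝ} (hT : T = t ^ ((N : ℝ) / 2))
    (x : Space N) :
    kernelMean (egauss N t) (fun y => ‖φ y‖ₑ) x ≤ strongNorm Φ r α φ *
      ENNReal.ofReal (T ^ (-(r⁻¹).toReal) * Φ T⁻¹ ^ (-α * (r⁻¹).toReal)) := by
  rcases eq_or_ne r ∞ with rfl | hrt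
  · simpa [strongNorm] using kernelMean_le_eLpNorm_top ht φ x
  have hT0 : 0 < T := hT ▸ Real.rpow_pos_of_pos ht _
  have hρ : 0 < r.toReal := ENNReal.toReal_pos (zero_lt_one.trans_le hr).ne' hrt
  have hρ1 : 1 ≤ r.toReal := ENNReal.toReal_one ▸ ENNReal.toReal_mono hrt hr
  refine le_mul_ofReal_weight_of_rpow_le hΦ hr hrt hT0
    (le_trans ?_ ((strongNorm_le_iff hΦ hr hrt).1 le_rfl T hT0))
  simp_rw [← decRearr_rpow _ hρ]
  refine le_trans ?_ (ofReal_mul_kernelMean_le (measurable_egauss N t) (lintegral_egauss ht)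
      (hφ.enorm.pow_const _) hT0 (fun x => hT ▸ egauss_le ht x) x)
  gcongr
  exact kernelMean_rpow_le (measurable_egauss N t) (lintegral_egauss ht) hφ.enorm hρ1 x

/-- Hardy's inequality in the weak space. -/
theorem exists_lintegral_decRearr_le_weakNorm (N : ℕ) (hΦ : IsWeight Φ) (hr : 1 < r) (hrt : r ≠ ∞)
    (α : ℝ) :
    ∃ C : ℝ, 0 < C ∧ ∀ φ : Space N → ℝ, ∀ s : ℝ, 0 < s →
      ∫⁻ τ in Ioo 0 s, decRearr volume (fun x => ‖φ x‖ₑ) τ ≤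
        ENNReal.ofReal s * (ENNReal.ofReal C * weakNorm Φ r α φ *
          ENNReal.ofReal (s ^ (-(r⁻¹).toReal) * Φ s⁻¹ ^ (-α * (r⁻¹).toReal))) := by
  have ha : (r⁻¹).toReal < 1 := by
    rw [← ENNReal.toReal_one]
    exact (ENNReal.toReal_lt_toReal (by simpa using (zero_lt_one.trans hr).ne') (by simp)).2
      (ENNReal.inv_lt_one.2 hr)
  obtain ⟨C, hC, h⟩ := hΦ.exists_lintegral_Ioo_le ha (-α * (r⁻¹).toReal)
  refine ⟨C, hC, fun φ s hs => ?_⟩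
  -- An infinite norm is set aside because the norm is later pulled out of an integral as a finite
  -- constant.
  rcases eq_or_ne (weakNorm Φ r α φ) ∞ with hM | hM
  · have hp := hΦ.pos_inv hs
    have : ENNReal.ofReal s * (ENNReal.ofReal C * weakNorm Φ r α φ *
          ENNReal.ofReal (s ^ (-(r⁻¹).toReal) * Φ s⁻¹ ^ (-α * (r⁻¹).toReal))) = ∞ := by
      rw [hM, ENNReal.mul_top (by simpa using hC), ENNReal.top_mul, ENNReal.mul_top]
      · simpa using hs
      · simp only [ne_eq, ENNReal.ofReal_eq_zero, not_le]
        positivity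
    exact this ▸ le_top
  calc ∫⁻ τ in Ioo 0 s, decRearr volume (fun x => ‖φ x‖ₑ) τ
      ≤ ∫⁻ τ in Ioo 0 s, weakNorm Φ r α φ *
          ENNReal.ofReal (τ ^ (-(r⁻¹).toReal) * Φ τ⁻¹ ^ (-α * (r⁻¹).toReal)) :=
        setLIntegral_mono' measurableSet_Ioo fun τ hτ =>
          (weakNorm_le_iff hΦ hr.le hrt).1 le_rfl τ hτ.1
    _ = weakNorm Φ r α φ * ∫⁻ τ in Ioo 0 s,
          ENNReal.ofReal (τ ^ (-(r⁻¹).toReal) * Φ τ⁻¹ ^ (-α * (r⁻¹).toReal)) :=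
        lintegral_const_mul' _ _ hM
    _ ≤ weakNorm Φ r α φ * ENNReal.ofReal (C * (s ^ (1 - (r⁻¹).toReal) *
          Φ s⁻¹ ^ (-α * (r⁻¹).toReal))) := by
        gcongr
        exact h s hs
    _ = _ := by
        rw [sub_eq_add_neg, Real.rpow_add hs, Real.rpow_one, mul_assoc s,
          ENNReal.ofReal_mul hC.le, ENNReal.ofReal_mul hs.le]
        ring

/-- Both bounds pass through `∫_0^s φ^*`, which Hardy's inequality controls by the weak norm; this
replaces Jensen. -/
theorem exists_weakNorm_heatSemigroup_le (N : ℕ) (hΦ : IsWeight Φ) (hr : 1 < r) (α : ℝ) :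
    ∃ C : ℝ, 0 < C ∧ ∀ φ : Space N → ℝ, AEStronglyMeasurable φ volume → ∀ t : ℝ, 0 < t →
      weakNorm Φ r α (heatSemigroup N t φ) ≤ ENNReal.ofReal C * weakNorm Φ r α φ ∧
      ∀ x, kernelMean (egauss N t) (fun y => ‖φ y‖ₑ) x ≤ ENNReal.ofReal C * weakNorm Φ r α φ *
        ENNReal.ofReal ((t ^ ((N : ℝ) / 2)) ^ (-(r⁻¹).toReal) *
          Φ (t ^ ((N : ℝ) / 2))⁻¹ ^ (-α * (r⁻¹).toReal)) := by
  rcases eq_or_ne r ∞ with rfl | hrt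
  · refine ⟨1, one_pos, fun φ hφ t ht => ⟨?_, fun x => ?_⟩⟩
    · simpa [weakNorm, strongNorm] using
        strongNorm_heatSemigroup_le (α := α) hΦ le_top ht hφ
    · simpa [weakNorm] using kernelMean_le_eLpNorm_top ht φ x
  obtain ⟨C, hC, h⟩ := exists_lintegral_decRearr_le_weakNorm N hΦ hr hrt α
  refine ⟨C, hC, fun φ hφ t ht => ⟨?_, fun x => ?_⟩⟩
  · rw [weakNorm_le_iff hΦ hr.le hrt]
    intro s hs
    have hs0 : ENNReal.ofReal s ≠ 0 := by simpa using hs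
    rw [← ENNReal.mul_le_mul_iff_right hs0 ENNReal.ofReal_ne_top]
    refine le_trans ?_ (h φ s hs)
    refine le_trans ?_ (lintegral_decRearr_kernelMean_le (measurable_egauss N t)
      (lintegral_egauss ht) hφ.enorm hs)
    refine le_trans ?_ (ofReal_mul_decRearr_le_lintegral _ s)
    gcongr
    exact decRearr_mono (enorm_heatSemigroup_le ht φ) s
  · have hT0 : 0 < t ^ ((N : ℝ) / 2) := Real.rpow_pos_of_pos ht _
    have hs0 : ENNReal.ofReal (t ^ ((N : ℝ) / 2)) ≠ 0 := by simpa using hT0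
    rw [← ENNReal.mul_le_mul_iff_right hs0 ENNReal.ofReal_ne_top]
    exact (ofReal_mul_kernelMean_le (measurable_egauss N t) (lintegral_egauss ht)
      hφ.enorm hT0 (egauss_le ht) x).trans (h φ _ hT0)

end HeatBounds

/-! ### Interpolation between an `r₁`-norm and a sup bound. -/

section Embedding

variable {N : ℕ} {Φ : ℝ → ℝ} {r r₁ r₂ : ℝ≥0∞} {α β : ℝ}

/-- The decay factor in terms of the volume scale `T = t^{N/2}`. -/
def volumeFactor (Φ : ℝ → ℝ) (r₁ r₂ : ℝ≥0∞) (α β T : ℝ) : ℝ :=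
  T ^ (-((r₁⁻¹).toReal - (r₂⁻¹).toReal)) * Φ T⁻¹ ^ (-α * (r₁⁻¹).toReal + β * (r₂⁻¹).toReal)

theorem exists_volumeFactor_le_decayFactor (hN : 1 ≤ N) (hΦ : IsWeight Φ) (r₁ r₂ : ℝ≥0∞)
    (α β : ℝ) : ∃ C : ℝ, 0 < C ∧ ∀ t : ℝ, 0 < t →
      volumeFactor Φ r₁ r₂ α β (t ^ ((N : ℝ) / 2)) ≤ C * decayFactor N Φ r₁ r₂ α β t := by
  have hN0 : (0 : ℝ) < N := by exact_mod_cast hN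
  obtain ⟨C, hC, h⟩ := hΦ.exists_inv_rpow_rpow_le (κ := (N : ℝ) / 2) (by positivity)
    (-α * (r₁⁻¹).toReal + β * (r₂⁻¹).toReal)
  refine ⟨C, hC, fun t ht => ?_⟩
  rw [volumeFactor, decayFactor, ← Real.rpow_mul ht.le, mul_neg, ← neg_mul, mul_left_comm]
  exact mul_le_mul_of_nonneg_left (h t ht) (by positivity)

theorem rpow_volumeFactor (hΦ : IsWeight Φ) (hr : 1 ≤ r₂) (hrt : r₂ ≠ ∞) {T : ℝ} (hT : 0 < T) :
    volumeFactor Φ r₁ r₂ α β T ^ r₂.toReal =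
      T * (T ^ (-(r₁⁻¹).toReal) * Φ T⁻¹ ^ (-α * (r₁⁻¹).toReal)) ^ r₂.toReal * Φ T⁻¹ ^ β := by
  have hρ : 0 < r₂.toReal := ENNReal.toReal_pos (zero_lt_one.trans_le hr).ne' hrt
  have hp := hΦ.pos_inv hT
  rw [volumeFactor, Real.mul_rpow (by positivity) (by positivity),
    Real.mul_rpow (by positivity) (by positivity), ← Real.rpow_mul hT.le, ← Real.rpow_mul hT.le,
    ← Real.rpow_mul hp.le, ← Real.rpow_mul hp.le, ENNReal.toReal_inv r₂]
  have e1 : -((r₁⁻¹).toReal - r₂.toReal⁻¹) * r₂.toReal = 1 + -(r₁⁻¹).toReal * r₂.toReal := by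
    field_simp
    ring
  have e2 : (-α * (r₁⁻¹).toReal + β * r₂.toReal⁻¹) * r₂.toReal =
      -α * (r₁⁻¹).toReal * r₂.toReal + β := by
    field_simp
  rw [e1, e2, Real.rpow_add hT, Real.rpow_add hp, Real.rpow_one]
  ring

theorem volumeFactor_nonneg (hΦ : IsWeight Φ) {T : ℝ} (hT : 0 < T) :
    0 ≤ volumeFactor Φ r₁ r₂ α β T := by
  have hp := hΦ.pos_inv hT
  unfold volumeFactor
  positivity

/-- A reformulation of `strongNorm_le_iff` for bounds by multiples of `volumeFactor`. -/
theorem strongNorm_le_mul_volumeFactor (hΦ : IsWeight Φ) (hr : 1 ≤ r₂) (hrt : r₂ ≠ ∞)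
    {T C : ℝ} (hT : 0 < T) (hC : 0 < C) {u : Space N → ℝ} {A : ℝ≥0∞}
    (h : ∀ s : ℝ, 0 < s → ∫⁻ τ in Ioo 0 s, decRearr volume (fun x => ‖u x‖ₑ) τ ^ r₂.toReal ≤
      A ^ r₂.toReal * ENNReal.ofReal (C *
        (T * (T ^ (-(r₁⁻¹).toReal) * Φ T⁻¹ ^ (-α * (r₁⁻¹).toReal)) ^ r₂.toReal * Φ T⁻¹ ^ β) *
          Φ s⁻¹ ^ (-β))) :
    strongNorm Φ r₂ β u ≤
      A * ENNReal.ofReal (C ^ (1 / r₂.toReal) * volumeFactor Φ r₁ r₂ α β T) := by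
  have hρ : 0 < r₂.toReal := ENNReal.toReal_pos (zero_lt_one.trans_le hr).ne' hrt
  rw [strongNorm_le_iff hΦ hr hrt]
  intro s hs
  have hp := hΦ.pos_inv hT
  have hv : 0 ≤ volumeFactor Φ r₁ r₂ α β T := volumeFactor_nonneg hΦ hT
  refine (h s hs).trans_eq ?_
  rw [← rpow_volumeFactor hΦ hr hrt hT, ENNReal.mul_rpow_of_nonneg _ _ hρ.le,
    ENNReal.ofReal_rpow_of_nonneg (by positivity) hρ.le,
    Real.mul_rpow (by positivity) hv, ← Real.rpow_mul hC.le,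
    one_div_mul_cancel hρ.ne', Real.rpow_one, mul_assoc (A ^ _), ← ENNReal.ofReal_mul (by positivity)]

/-- Below `T` the sup bound is used, above `T` the weak bound; the tail converges because `r₂ / r₁ >
1`, and both pieces have size `T·w(T)^{r₂}`. -/
theorem exists_strongNorm_le_of_weakNorm_le (N : ℕ) (hΦ : IsWeight Φ) (hr₁ : 1 ≤ r₁) (hr : r₁ < r₂)
    (α : ℝ) (hβ : 0 ≤ β) :
    ∃ C : ℝ, 0 < C ∧ ∀ (u : Space N → ℝ) (A : ℝ≥0∞) (T : ℝ), 0 < T → A ≠ ∞ →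
      weakNorm Φ r₁ α u ≤ A →
      (∀ x, ‖u x‖ₑ ≤
        A * ENNReal.ofReal (T ^ (-(r₁⁻¹).toReal) * Φ T⁻¹ ^ (-α * (r₁⁻¹).toReal))) →
      strongNorm Φ r₂ β u ≤ A * ENNReal.ofReal (C * volumeFactor Φ r₁ r₂ α β T) := by
  rcases eq_or_ne r₂ ∞ with rfl | hrt
  · refine ⟨1, one_pos, fun u A T hT hA _ h => (strongNorm_top_le h).trans_eq ?_⟩
    simp [volumeFactor]
  have hr₂ := hr₁.trans hr.le
  have hr₁t : r₁ ≠ ∞ := (hr.trans_le le_top).ne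
  have hρ : 0 < r₂.toReal := ENNReal.toReal_pos (zero_lt_one.trans_le hr₂).ne' hrt
  have hρ₁ : 0 < r₁.toReal := ENNReal.toReal_pos (zero_lt_one.trans_le hr₁).ne' hr₁t
  set a := (r₁⁻¹).toReal with ha
  set q := r₂.toReal with hq
  have haq : 1 < a * q := by
    rw [ha, ENNReal.toReal_inv, inv_mul_eq_div, one_lt_div hρ₁]
    exact (ENNReal.toReal_lt_toReal hr₁t hrt).2 hr
  have hw : ∀ τ : ℝ, 0 < τ → (τ ^ (-a) * Φ τ⁻¹ ^ (-α * a)) ^ q =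
      τ ^ (-(a * q)) * Φ τ⁻¹ ^ (-α * a * q) := fun τ hτ => by
    have := hΦ.pos_inv hτ
    rw [Real.mul_rpow (by positivity) (by positivity), ← Real.rpow_mul hτ.le,
      ← Real.rpow_mul this.le, neg_mul]
  obtain ⟨C₀, hC₀, h₀⟩ := hΦ.exists_rpow_mul_le one_pos β
  obtain ⟨C₁, hC₁, h₁⟩ := hΦ.exists_lintegral_Ioi_le haq (-α * a * q)
  have hC : 0 < C₀ + (1 + C₁) := by positivity
  refine ⟨(C₀ + (1 + C₁)) ^ (1 / q), by positivity, fun u A T hT hA hu hb => ?_⟩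
  refine strongNorm_le_mul_volumeFactor hΦ hr₂ hrt hT hC fun s hs => ?_
  have hpT := hΦ.pos_inv hT
  have hps := hΦ.pos_inv hs
  set v : ℝ → ℝ≥0∞ := decRearr volume (fun x => ‖u x‖ₑ) with hv
  set W : ℝ := (T ^ (-a) * Φ T⁻¹ ^ (-α * a)) ^ q with hW
  have hW0 : 0 < W := by positivity
  have hAq : A ^ q ≠ ∞ := ENNReal.rpow_ne_top_of_nonneg hρ.le hA
  have near : ∀ S : ℝ, 0 < S →
      ∫⁻ τ in Ioo 0 S, v τ ^ q ≤ A ^ q * ENNReal.ofReal (S * W) := by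
    intro S hS
    calc ∫⁻ τ in Ioo 0 S, v τ ^ q ≤ ∫⁻ _ in Ioo 0 S, A ^ q * ENNReal.ofReal W := by
          refine lintegral_mono fun τ => ?_
          rw [hW, ← ENNReal.ofReal_rpow_of_pos (by positivity),
            ← ENNReal.mul_rpow_of_nonneg _ _ hρ.le]
          exact ENNReal.rpow_le_rpow (decRearr_le_of_forall_le hb τ) hρ.le
      _ = _ := by
          rw [lintegral_const, Measure.restrict_apply_univ, Real.volume_Ioo, sub_zero, mul_assoc,
            ← ENNReal.ofReal_mul hW0.le, mul_comm W]
  have far : ∫⁻ τ in Ioi T, v τ ^ q ≤ A ^ q * ENNReal.ofReal (C₁ * (T * W)) := by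
    calc ∫⁻ τ in Ioi T, v τ ^ q
        ≤ ∫⁻ τ in Ioi T, A ^ q * ENNReal.ofReal (τ ^ (-(a * q)) * Φ τ⁻¹ ^ (-α * a * q)) := by
          refine setLIntegral_mono' measurableSet_Ioi fun τ hτ => ?_
          have hτ0 : 0 < τ := hT.trans hτ
          have hpτ := hΦ.pos_inv hτ0
          rw [← hw τ hτ0, ← ENNReal.ofReal_rpow_of_pos (by positivity),
            ← ENNReal.mul_rpow_of_nonneg _ _ hρ.le]
          exact ENNReal.rpow_le_rpow ((weakNorm_le_iff hΦ hr₁ hr₁t).1 hu τ hτ0) hρ.le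
      _ ≤ A ^ q * ENNReal.ofReal (C₁ * (T ^ (1 - a * q) * Φ T⁻¹ ^ (-α * a * q))) := by
          rw [lintegral_const_mul' _ _ hAq]
          gcongr
          exact h₁ T hT
      _ = _ := by
          rw [hW, hw T hT, sub_eq_add_neg, Real.rpow_add hT, Real.rpow_one, mul_assoc T]
  have hone : Φ s⁻¹ ^ β * Φ s⁻¹ ^ (-β) = 1 := by
    rw [← Real.rpow_add hps, add_neg_cancel, Real.rpow_zero]
  have hE : 0 ≤ T * W * Φ T⁻¹ ^ β * Φ s⁻¹ ^ (-β) := by positivity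
  -- For `s ≤ T` the weight is paid for by the almost monotonicity of `s Φ(1/s)^β`; for `s ≥ T` by
  -- `Φ(1/s)^β ≤ Φ(1/T)^β`.
  rcases le_total s T with hsT | hTs
  · refine (near s hs).trans ?_
    refine mul_le_mul' le_rfl (ENNReal.ofReal_le_ofReal ?_)
    have h := h₀ s T hs hsT
    rw [Real.rpow_one, Real.rpow_one] at h
    calc s * W = (s * Φ s⁻¹ ^ β) * (W * Φ s⁻¹ ^ (-β)) := by
          linear_combination (-(s * W)) * hone
      _ ≤ (C₀ * (T * Φ T⁻¹ ^ β)) * (W * Φ s⁻¹ ^ (-β)) := by gcongr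
      _ ≤ (C₀ + (1 + C₁)) * (T * W * Φ T⁻¹ ^ β * Φ s⁻¹ ^ (-β)) := by
          nlinarith [mul_nonneg hC₁.le hE]
      _ = _ := by ring
  · calc ∫⁻ τ in Ioo 0 s, v τ ^ q ≤ ∫⁻ τ in Ioc 0 T ∪ Ioi T, v τ ^ q :=
          lintegral_mono_set fun τ hτ => by
            rw [Ioc_union_Ioi_eq_Ioi hT.le]
            exact hτ.1
      _ ≤ (∫⁻ τ in Ioc 0 T, v τ ^ q) + ∫⁻ τ in Ioi T, v τ ^ q := lintegral_union_le _ _ _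
      _ ≤ A ^ q * ENNReal.ofReal (T * W) + A ^ q * ENNReal.ofReal (C₁ * (T * W)) := by
          rw [restrict_Ioo_eq_restrict_Ioc.symm]
          exact add_le_add (near T hT) far
      _ = A ^ q * ENNReal.ofReal ((1 + C₁) * (T * W)) := by
          rw [← mul_add, ← ENNReal.ofReal_add (by positivity) (by positivity)]
          ring_nf
      _ ≤ _ := by
          refine mul_le_mul' le_rfl (ENNReal.ofReal_le_ofReal ?_)
          have h' : Φ s⁻¹ ^ β ≤ Φ T⁻¹ ^ β := Real.rpow_le_rpow hps.le (hΦ.inv_le_inv hT hTs) hβ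
          calc (1 + C₁) * (T * W) = (1 + C₁) * (T * W) * (Φ s⁻¹ ^ β * Φ s⁻¹ ^ (-β)) := by
                rw [hone, mul_one]
            _ ≤ (1 + C₁) * (T * W) * (Φ T⁻¹ ^ β * Φ s⁻¹ ^ (-β)) := by gcongr
            _ ≤ (C₀ + (1 + C₁)) * (T * W * Φ T⁻¹ ^ β * Φ s⁻¹ ^ (-β)) := by
                nlinarith [mul_nonneg hC₀.le hE]
            _ = _ := by ring

/-- With equal exponents the power in the tail is the borderline `τ⁻¹`, so for `s ≥ T` the norm
bound is used directly; `α ≤ β` gives `Φ(1/s)^{β-α} ≤ Φ(1/T)^{β-α}`. -/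
theorem exists_strongNorm_le_of_strongNorm_le (N : ℕ) (hΦ : IsWeight Φ) (hr : 1 ≤ r)
    (hαβ : α ≤ β) :
    ∃ C : ℝ, 0 < C ∧ ∀ (u : Space N → ℝ) (A : ℝ≥0∞) (T : ℝ), 0 < T →
      strongNorm Φ r α u ≤ A →
      (∀ x, ‖u x‖ₑ ≤
        A * ENNReal.ofReal (T ^ (-(r⁻¹).toReal) * Φ T⁻¹ ^ (-α * (r⁻¹).toReal))) →
      strongNorm Φ r β u ≤ A * ENNReal.ofReal (C * volumeFactor Φ r r α β T) := by
  rcases eq_or_ne r ∞ with rfl | hrt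
  · refine ⟨1, one_pos, fun u A T hT _ h => (strongNorm_top_le h).trans_eq ?_⟩
    simp [volumeFactor]
  have hρ : 0 < r.toReal := ENNReal.toReal_pos (zero_lt_one.trans_le hr).ne' hrt
  obtain ⟨C, hC, h₀⟩ := hΦ.exists_rpow_mul_le one_pos β
  refine ⟨(C + 1) ^ (1 / r.toReal), by positivity, fun u A T hT hu hb => ?_⟩
  refine strongNorm_le_mul_volumeFactor hΦ hr hrt hT (by positivity) fun s hs => ?_
  have hpT := hΦ.pos_inv hT
  have hps := hΦ.pos_inv hs
  rw [rpow_weight_rpow hΦ hr hrt hT, mul_inv_cancel_left₀ hT.ne']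
  have hone : Φ s⁻¹ ^ β * Φ s⁻¹ ^ (-β) = 1 := by
    rw [← Real.rpow_add hps, add_neg_cancel, Real.rpow_zero]
  have hE : 0 ≤ Φ T⁻¹ ^ (-α) * Φ T⁻¹ ^ β * Φ s⁻¹ ^ (-β) := by positivity
  rcases le_total s T with hsT | hTs
  · calc ∫⁻ τ in Ioo 0 s, decRearr volume (fun x => ‖u x‖ₑ) τ ^ r.toReal
        ≤ ∫⁻ _ in Ioo 0 s, A ^ r.toReal * ENNReal.ofReal (T⁻¹ * Φ T⁻¹ ^ (-α)) := by
          refine lintegral_mono fun τ => ?_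
          rw [← rpow_weight_rpow hΦ hr hrt hT, ← ENNReal.ofReal_rpow_of_pos (by positivity),
            ← ENNReal.mul_rpow_of_nonneg _ _ hρ.le]
          exact ENNReal.rpow_le_rpow (decRearr_le_of_forall_le hb τ) hρ.le
      _ = A ^ r.toReal * ENNReal.ofReal (T⁻¹ * Φ T⁻¹ ^ (-α) * s) := by
          rw [lintegral_const, Measure.restrict_apply_univ, Real.volume_Ioo, sub_zero, mul_assoc,
            ← ENNReal.ofReal_mul (by positivity)]
      _ ≤ _ := by
          refine mul_le_mul' le_rfl (ENNReal.ofReal_le_ofReal ?_)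
          have h := h₀ s T hs hsT
          rw [Real.rpow_one, Real.rpow_one] at h
          calc T⁻¹ * Φ T⁻¹ ^ (-α) * s
              = T⁻¹ * Φ T⁻¹ ^ (-α) * Φ s⁻¹ ^ (-β) * (s * Φ s⁻¹ ^ β) := by
                linear_combination (-(T⁻¹ * Φ T⁻¹ ^ (-α) * s)) * hone
            _ ≤ T⁻¹ * Φ T⁻¹ ^ (-α) * Φ s⁻¹ ^ (-β) * (C * (T * Φ T⁻¹ ^ β)) := by gcongr
            _ = C * (Φ T⁻¹ ^ (-α) * Φ T⁻¹ ^ β * Φ s⁻¹ ^ (-β)) := by field_simp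
            _ ≤ _ := by linarith
  · refine ((strongNorm_le_iff hΦ hr hrt).1 hu s hs).trans ?_
    refine mul_le_mul' le_rfl (ENNReal.ofReal_le_ofReal ?_)
    have h' : Φ s⁻¹ ^ (β - α) ≤ Φ T⁻¹ ^ (β - α) :=
      Real.rpow_le_rpow hps.le (hΦ.inv_le_inv hT hTs) (sub_nonneg.2 hαβ)
    calc Φ s⁻¹ ^ (-α) = Φ s⁻¹ ^ (β - α) * Φ s⁻¹ ^ (-β) := by
          rw [← Real.rpow_add hps]
          ring_nf
      _ ≤ Φ T⁻¹ ^ (β - α) * Φ s⁻¹ ^ (-β) := by gcongr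
      _ = Φ T⁻¹ ^ (-α) * Φ T⁻¹ ^ β * Φ s⁻¹ ^ (-β) := by
          rw [← Real.rpow_add hpT]
          ring_nf
      _ ≤ _ := by nlinarith [mul_nonneg hC.le hE]

/-- The same dichotomy at `T`, applied pointwise to the rearrangement instead of to its integral. -/
theorem exists_weakNorm_le_of_weakNorm_le (N : ℕ) (hΦ : IsWeight Φ) (hr : 1 ≤ r)
    (hαβ : α ≤ β) :
    ∃ C : ℝ, 0 < C ∧ ∀ (u : Space N → ℝ) (A : ℝ≥0∞) (T : ℝ), 0 < T →
      weakNorm Φ r α u ≤ A →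
      (∀ x, ‖u x‖ₑ ≤
        A * ENNReal.ofReal (T ^ (-(r⁻¹).toReal) * Φ T⁻¹ ^ (-α * (r⁻¹).toReal))) →
      weakNorm Φ r β u ≤ A * ENNReal.ofReal (C * volumeFactor Φ r r α β T) := by
  rcases eq_or_ne r ∞ with rfl | hrt
  · refine ⟨1, one_pos, fun u A T hT _ h => (weakNorm_le_strongNorm hΦ le_top u).trans
      ((strongNorm_top_le h).trans_eq ?_)⟩
    simp [volumeFactor]
  have hρ : 0 < r.toReal := ENNReal.toReal_pos (zero_lt_one.trans_le hr).ne' hrt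
  set a := (r⁻¹).toReal with ha
  have ha0 : 0 < a := by
    rw [ha, ENNReal.toReal_inv]
    positivity
  obtain ⟨C, hC, h₀⟩ := hΦ.exists_rpow_mul_le ha0 (β * a)
  refine ⟨C + 1, by positivity, fun u A T hT hu hb => ?_⟩
  rw [weakNorm_le_iff hΦ hr hrt]
  intro s hs
  have hpT := hΦ.pos_inv hT
  have hps := hΦ.pos_inv hs
  have hv : volumeFactor Φ r r α β T = Φ T⁻¹ ^ (-α * a) * Φ T⁻¹ ^ (β * a) := by
    rw [volumeFactor, sub_self, neg_zero, Real.rpow_zero, one_mul, Real.rpow_add hpT]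
  have hone : Φ s⁻¹ ^ (β * a) * Φ s⁻¹ ^ (-β * a) = 1 := by
    rw [← Real.rpow_add hps, neg_mul, add_neg_cancel, Real.rpow_zero]
  have hones : s ^ a * s ^ (-a) = 1 := by
    rw [← Real.rpow_add hs, add_neg_cancel, Real.rpow_zero]
  have honeT : T ^ (-a) * T ^ a = 1 := by
    rw [← Real.rpow_add hT, neg_add_cancel, Real.rpow_zero]
  rw [hv, mul_assoc A, ← ENNReal.ofReal_mul (by positivity), ← ha]
  have hE : 0 ≤ Φ T⁻¹ ^ (-α * a) * Φ T⁻¹ ^ (β * a) * (s ^ (-a) * Φ s⁻¹ ^ (-β * a)) := by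
    positivity
  rcases le_total s T with hsT | hTs
  · refine (decRearr_le_of_forall_le hb s).trans ?_
    refine mul_le_mul' le_rfl (ENNReal.ofReal_le_ofReal ?_)
    have h := h₀ s T hs hsT
    calc T ^ (-a) * Φ T⁻¹ ^ (-α * a)
        = T ^ (-a) * Φ T⁻¹ ^ (-α * a) * (s ^ (-a) * Φ s⁻¹ ^ (-β * a)) *
            (s ^ a * Φ s⁻¹ ^ (β * a)) := by
          rw [show T ^ (-a) * Φ T⁻¹ ^ (-α * a) * (s ^ (-a) * Φ s⁻¹ ^ (-β * a)) *
            (s ^ a * Φ s⁻¹ ^ (β * a)) = T ^ (-a) * Φ T⁻¹ ^ (-α * a) * (s ^ a * s ^ (-a)) *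
            (Φ s⁻¹ ^ (β * a) * Φ s⁻¹ ^ (-β * a)) by ring, hone, hones, mul_one, mul_one]
      _ ≤ T ^ (-a) * Φ T⁻¹ ^ (-α * a) * (s ^ (-a) * Φ s⁻¹ ^ (-β * a)) *
            (C * (T ^ a * Φ T⁻¹ ^ (β * a))) := by gcongr
      _ = C * (Φ T⁻¹ ^ (-α * a) * Φ T⁻¹ ^ (β * a) * (s ^ (-a) * Φ s⁻¹ ^ (-β * a))) *
            (T ^ (-a) * T ^ a) := by ring
      _ ≤ _ := by
          rw [honeT]
          linarith
  · refine ((weakNorm_le_iff hΦ hr hrt).1 hu s hs).trans ?_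
    refine mul_le_mul' le_rfl (ENNReal.ofReal_le_ofReal ?_)
    have h' : Φ s⁻¹ ^ ((β - α) * a) ≤ Φ T⁻¹ ^ ((β - α) * a) :=
      Real.rpow_le_rpow hps.le (hΦ.inv_le_inv hT hTs) (mul_nonneg (sub_nonneg.2 hαβ) ha0.le)
    calc s ^ (-a) * Φ s⁻¹ ^ (-α * a)
        = Φ s⁻¹ ^ ((β - α) * a) * (s ^ (-a) * Φ s⁻¹ ^ (-β * a)) := by
          rw [mul_left_comm, ← Real.rpow_add hps]
          ring_nf
      _ ≤ Φ T⁻¹ ^ ((β - α) * a) * (s ^ (-a) * Φ s⁻¹ ^ (-β * a)) := by gcongr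
      _ = Φ T⁻¹ ^ (-α * a) * Φ T⁻¹ ^ (β * a) * (s ^ (-a) * Φ s⁻¹ ^ (-β * a)) := by
          rw [← Real.rpow_add hpT]
          ring_nf
      _ ≤ _ := by nlinarith [mul_nonneg hC.le hE]

end Embedding

/-! ### From the volume scale to the decay estimate. -/

section Semigroup

variable {N : ℕ} {Φ : ℝ → ℝ} {r₁ r₂ : ℝ≥0∞} {α β : ℝ}

/-- Passage from estimates at the volume scale `t^{N/2}`, for functions controlled by a multiple
of an arbitrary norm `n₁`, to the decay estimate with membership and absolute convergence. -/
theorem exists_heatSemigroup_bound (hN : 1 ≤ N) (hΦ : IsWeight Φ) {n₁ n₂ : (Space N → ℝ) → ℝ≥0∞}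
    {K C : ℝ} (hK : 0 < K) (hC : 0 < C)
    (hbound : ∀ φ : Space N → ℝ, AEStronglyMeasurable φ volume → ∀ t : ℝ, 0 < t →
      ∀ x, kernelMean (egauss N t) (fun y => ‖φ y‖ₑ) x ≤ ENNReal.ofReal K * n₁ φ *
        ENNReal.ofReal ((t ^ ((N : ℝ) / 2)) ^ (-(r₁⁻¹).toReal) *
          Φ (t ^ ((N : ℝ) / 2))⁻¹ ^ (-α * (r₁⁻¹).toReal)))
    (hnorm : ∀ φ : Space N → ℝ, AEStronglyMeasurable φ volume → n₁ φ < ∞ → ∀ t : ℝ, 0 < t →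
      (∀ x, ‖heatSemigroup N t φ x‖ₑ ≤ ENNReal.ofReal K * n₁ φ *
        ENNReal.ofReal ((t ^ ((N : ℝ) / 2)) ^ (-(r₁⁻¹).toReal) *
          Φ (t ^ ((N : ℝ) / 2))⁻¹ ^ (-α * (r₁⁻¹).toReal))) →
      n₂ (heatSemigroup N t φ) ≤ ENNReal.ofReal K * n₁ φ *
        ENNReal.ofReal (C * volumeFactor Φ r₁ r₂ α β (t ^ ((N : ℝ) / 2)))) :
    ∃ C : ℝ, 0 < C ∧ ∀ φ : Space N → ℝ, (LocallyIntegrable φ volume ∧ n₁ φ < ∞) →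
      ∀ t : ℝ, 0 < t → HeatIntegrable N t φ ∧
        (LocallyIntegrable (heatSemigroup N t φ) volume ∧ n₂ (heatSemigroup N t φ) < ∞) ∧
        n₂ (heatSemigroup N t φ) ≤
          ENNReal.ofReal (C * decayFactor N Φ r₁ r₂ α β t) * n₁ φ := by
  obtain ⟨C', hC', hdecay⟩ := exists_volumeFactor_le_decayFactor hN hΦ r₁ r₂ α β
  refine ⟨K * (C * C'), by positivity, fun φ hφ t ht => ?_⟩
  have hm := hφ.1.aestronglyMeasurable
  have hA : ENNReal.ofReal K * n₁ φ ≠ ∞ := ENNReal.mul_ne_top ENNReal.ofReal_ne_top hφ.2.ne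
  have hb := hbound φ hm t ht
  have hu := fun x => (enorm_heatSemigroup_le ht φ x).trans (hb x)
  have hn := hnorm φ hm hφ.2 t ht hu
  refine ⟨heatIntegrable_of_kernelMean_ne_top ht hm fun x =>
      ((hb x).trans_lt (ENNReal.mul_lt_top hA.lt_top ENNReal.ofReal_lt_top)).ne,
    ⟨locallyIntegrable_of_enorm_le (aestronglyMeasurable_heatSemigroup t hm)
      (ENNReal.mul_ne_top hA ENNReal.ofReal_ne_top) hu,
      hn.trans_lt (ENNReal.mul_lt_top hA.lt_top ENNReal.ofReal_lt_top)⟩, hn.trans ?_⟩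
  rw [mul_right_comm, ← ENNReal.ofReal_mul hK.le]
  refine mul_le_mul' (ENNReal.ofReal_le_ofReal ?_) le_rfl
  calc K * (C * volumeFactor Φ r₁ r₂ α β (t ^ ((N : ℝ) / 2)))
      ≤ K * (C * (C' * decayFactor N Φ r₁ r₂ α β t)) := by
        gcongr
        exact hdecay t ht
    _ = _ := by ring

end Semigroup

end WeakZygmund

end

/-! ### The three estimates. -/

theorem proposition3p1 (N : ℕ) (hN : 1 ≤ N) (Φ : ℝ → ℝ) (hΦ : WeakZygmund.IsWeight Φ)
    (r₁ r₂ : ℝ≥0∞) (hr₁ : 1 ≤ r₁) (hr : r₁ ≤ r₂)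
    (α β : ℝ) (hα : 0 ≤ α) (hβ : 0 ≤ β) (hαβ : r₁ = r₂ → α ≤ β) :
    (∃ C : ℝ, 0 < C ∧ ∀ φ ∈ WeakZygmund.strongSpace N Φ r₁ α, ∀ t : ℝ, 0 < t →
      WeakZygmund.HeatIntegrable N t φ ∧
      WeakZygmund.heatSemigroup N t φ ∈ WeakZygmund.strongSpace N Φ r₂ β ∧
      WeakZygmund.strongNorm Φ r₂ β (WeakZygmund.heatSemigroup N t φ) ≤
        ENNReal.ofReal (C * WeakZygmund.decayFactor N Φ r₁ r₂ α β t) *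
          WeakZygmund.strongNorm Φ r₁ α φ) ∧
    (1 < r₁ →
      ∃ C : ℝ, 0 < C ∧ ∀ φ ∈ WeakZygmund.weakSpace N Φ r₁ α, ∀ t : ℝ, 0 < t →
        WeakZygmund.HeatIntegrable N t φ ∧
        WeakZygmund.heatSemigroup N t φ ∈ WeakZygmund.weakSpace N Φ r₂ β ∧
        WeakZygmund.weakNorm Φ r₂ β (WeakZygmund.heatSemigroup N t φ) ≤
          ENNReal.ofReal (C * WeakZygmund.decayFactor N Φ r₁ r₂ α β t) *
            WeakZygmund.weakNorm Φ r₁ α φ) ∧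
    (1 < r₁ → r₁ < r₂ →
      ∃ C : ℝ, 0 < C ∧ ∀ φ ∈ WeakZygmund.weakSpace N Φ r₁ α, ∀ t : ℝ, 0 < t →
        WeakZygmund.HeatIntegrable N t φ ∧
        WeakZygmund.heatSemigroup N t φ ∈ WeakZygmund.strongSpace N Φ r₂ β ∧
        WeakZygmund.strongNorm Φ r₂ β (WeakZygmund.heatSemigroup N t φ) ≤
          ENNReal.ofReal (C * WeakZygmund.decayFactor N Φ r₁ r₂ α β t) *
            WeakZygmund.weakNorm Φ r₁ α φ) := by
  refine ⟨?_, fun h1 => ?_, fun h1 hlt => ?_⟩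
  · have hbound : ∀ φ : WeakZygmund.Space N → ℝ, AEStronglyMeasurable φ volume →
        ∀ t : ℝ, 0 < t → ∀ x, WeakZygmund.kernelMean (WeakZygmund.egauss N t)
          (fun y => ‖φ y‖ₑ) x ≤ ENNReal.ofReal 1 * WeakZygmund.strongNorm Φ r₁ α φ *
            ENNReal.ofReal ((t ^ ((N : ℝ) / 2)) ^ (-(r₁⁻¹).toReal) *
              Φ (t ^ ((N : ℝ) / 2))⁻¹ ^ (-α * (r₁⁻¹).toReal)) := fun φ hφ t ht x => by
      rw [ENNReal.ofReal_one, one_mul]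
      exact WeakZygmund.kernelMean_le_strongNorm hΦ hr₁ ht hφ rfl x
    have hself : ∀ φ : WeakZygmund.Space N → ℝ, AEStronglyMeasurable φ volume →
        ∀ t : ℝ, 0 < t → WeakZygmund.strongNorm Φ r₁ α (WeakZygmund.heatSemigroup N t φ) ≤
          ENNReal.ofReal 1 * WeakZygmund.strongNorm Φ r₁ α φ := fun φ hφ t ht => by
      rw [ENNReal.ofReal_one, one_mul]
      exact WeakZygmund.strongNorm_heatSemigroup_le hΦ hr₁ ht hφ
    rcases hr.eq_or_lt with rfl | hlt
    · obtain ⟨C, hC, h⟩ :=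
        WeakZygmund.exists_strongNorm_le_of_strongNorm_le N hΦ hr₁ (hαβ rfl)
      exact WeakZygmund.exists_heatSemigroup_bound hN hΦ one_pos hC hbound
        fun φ hφ _ t ht hu => h _ _ _ (Real.rpow_pos_of_pos ht _) (hself φ hφ t ht) hu
    -- For `r₁ < r₂` only the weak bound on `S(t)φ` enters, so this case allows `r₁ = 1`.
    · obtain ⟨C, hC, h⟩ := WeakZygmund.exists_strongNorm_le_of_weakNorm_le N hΦ hr₁ hlt α hβ
      exact WeakZygmund.exists_heatSemigroup_bound hN hΦ one_pos hC hbound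
        fun φ hφ hfin t ht hu => h _ _ _ (Real.rpow_pos_of_pos ht _)
          (ENNReal.mul_ne_top ENNReal.ofReal_ne_top hfin.ne)
          ((WeakZygmund.weakNorm_le_strongNorm hΦ hr₁ _).trans (hself φ hφ t ht)) hu
  · obtain ⟨K, hK, hheat⟩ := WeakZygmund.exists_weakNorm_heatSemigroup_le N hΦ h1 α
    rcases hr.eq_or_lt with rfl | hlt
    · obtain ⟨C, hC, h⟩ := WeakZygmund.exists_weakNorm_le_of_weakNorm_le N hΦ hr₁ (hαβ rfl)
      exact WeakZygmund.exists_heatSemigroup_bound hN hΦ hK hC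
        (fun φ hφ t ht => (hheat φ hφ t ht).2)
        fun φ hφ _ t ht hu => h _ _ _ (Real.rpow_pos_of_pos ht _) (hheat φ hφ t ht).1 hu
    -- For `r₁ < r₂` the weak-to-weak bound follows from the weak-to-strong one.
    · obtain ⟨C, hC, h⟩ := WeakZygmund.exists_strongNorm_le_of_weakNorm_le N hΦ hr₁ hlt α hβ
      exact WeakZygmund.exists_heatSemigroup_bound hN hΦ hK hC
        (fun φ hφ t ht => (hheat φ hφ t ht).2)
        fun φ hφ hfin t ht hu => (WeakZygmund.weakNorm_le_strongNorm hΦ (hr₁.trans hr) _).trans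
          (h _ _ _ (Real.rpow_pos_of_pos ht _)
            (ENNReal.mul_ne_top ENNReal.ofReal_ne_top hfin.ne) (hheat φ hφ t ht).1 hu)
  · obtain ⟨K, hK, hheat⟩ := WeakZygmund.exists_weakNorm_heatSemigroup_le N hΦ h1 α
    obtain ⟨C, hC, h⟩ := WeakZygmund.exists_strongNorm_le_of_weakNorm_le N hΦ hr₁ hlt α hβ
    exact WeakZygmund.exists_heatSemigroup_bound hN hΦ hK hC
      (fun φ hφ t ht => (hheat φ hφ t ht).2)
      fun φ hφ hfin t ht hu => h _ _ _ (Real.rpow_pos_of_pos ht _)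
        (ENNReal.mul_ne_top ENNReal.ofReal_ne_top hfin.ne) (hheat φ hφ t ht).1 hu
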